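/- Identify $\mathbb N$ with $\{0,1\}^*$ by $0\leftrightarrow\epsilon,\ 1\leftrightarrow 0,\ 2\leftrightarrow 1,\ 3\leftrightarrow 00,\ 4\leftrightarrow 01,\dots$, write $|p|$ for the length of a string $p$, and let $\langle x,y\rangle = 1^{|x|}\,0\,x\,y$ be the standard pairing of binary strings. Let $U$ be a universal Turing machine, that is, for every Turing machine $T$ there is a string $i$ with $U(\langle\langle i,p\rangle,y\rangle)=T(\langle p,y\rangle)$ for all $p,y$, and let $$C(x\mid y)=\min\{|p| : U(\langle p,y\rangle)=x\},\qquad C(x)=C(x\mid\epsilon)$$ be the (conditional) Kolmogorov complexity. A reversible Turing machine is a deterministic multitape Turing machine in which every configuration has at most one predecessor, whose start state is never entered and whose final state is never left; it starts with only its input on its tapes, and its output $R(w)=v$ is defined when it halts in the final state with only $v$ on its tapes. For a reversible Turing machine $R$ let $$E_R(x,y)=\min\{|p|+|q| : R(\langle x,p\rangle)=\langle y,q\rangle\}$$ be its irreversibility cost of computing $y$ from $x$ (with $\min\emptyset=\infty$). Let $UR$ be a reversible Turing machine that is universal for this cost, that is, for every reversible Turing machine $R$ there is a constant $c_R$ with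 $E_{UR}(x,y)\le E_R(x,y)+c_R$ for all $x,y$, and put $E(x,y)=E_{UR}(x,y)$. Then, up to a logarithmic additive term, the irreversibility cost of erasing a record $x$ is its Kolmogorov complexity, $E(x,\epsilon)=C(x)$. Precisely, there is a constant $c$, depending only on $U$ and $UR$, such that for every binary string $x$ the quantities $E(x,\epsilon)$, $C(x)$ and $C(C(x)\mid x)$ are finite and $$C(x)-c\ \le\ E(x,\epsilon)\ \le\ C(x)+2\,C(C(x)\mid x)+c,\qquad C(C(x)\mid x)\le \lfloor\log_2 (C(x)+1)\rfloor+c .$$ -/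

import Mathlib

namespace RevErasure

/-- Binary strings. -/
abbrev Word := List Bool

/-- The standard correspondence between natural numbers and binary strings,
`0 ↦ ε, 1 ↦ 0, 2 ↦ 1, 3 ↦ 00, 4 ↦ 01, …`: the binary expansion of `n + 1`, most significant
bit first, without its leading `1`. -/
def natToWord (n : ℕ) : Word := ((Nat.bits (n + 1)).dropLast).reverse

/-- The standard computable injective pairing `⟨x, y⟩ = 1^{|x|} 0 x y` of binary strings. -/
def pair (x y : Word) : Word := List.replicate x.length true ++ false :: (x ++ y)

/-! ### Kolmogorov complexity -/

/-- `U` is a universal Turing machine (a machine is represented by the partial computable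
function on strings that it computes): for every Turing machine `T` there is an index `i` with
`U ⟨⟨i, p⟩, y⟩ = T ⟨p, y⟩` for all `p, y`, where either both sides are undefined or both are
defined and equal. -/
def IsUniversal (U : Word →. Word) : Prop :=
  Partrec U ∧ ∀ T : Word →. Word, Partrec T →
    ∃ i : Word, ∀ p y : Word, U (pair (pair i p) y) = T (pair p y)

/-- `C(x | y)`: the least length of a program `p` with `U ⟨p, y⟩ = x` (`⊤` if there is none). -/
noncomputable def condComplexity (U : Word →. Word) (x y : Word) : ℕ∞ :=
  ⨅ (p : Word) (_ : x ∈ U (pair p y)), (p.length : ℕ∞)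

/-- `C(x) = C(x | ε)`. -/
noncomputable def complexity (U : Word →. Word) (x : Word) : ℕ∞ := condComplexity U x []

/-! ### Reversible Turing machines -/

/-- A deterministic multitape Turing machine with finitely many states, tapes and tape symbols.
The tape symbols are the blank `none`, the two bits `some (Sum.inl b)`, and auxiliary symbols
`some (Sum.inr a)`. In one step the machine reads the scanned symbol on every tape, and then, on
every tape, writes a symbol and moves the head by at most one cell (`none`: no move). If `δ` is
undefined the machine stops; this always happens in the state `final`. -/
structure TM where
  /-- states -/
  Q : Type
  /-- names of the tapes -/
  ι : Type
  /-- auxiliary tape symbols -/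
  A : Type
  finQ : Finite Q
  finι : Finite ι
  finA : Finite A
  start : Q
  final : Q
  /-- the tape that holds the input and the output -/
  io : ι
  δ : Q → (ι → Option (Bool ⊕ A)) → Option (Q × (ι → Option (Bool ⊕ A) × Option Turing.Dir))
  δ_final : ∀ a, δ final a = none

namespace TM

variable (M : TM)

/-- Instantaneous descriptions. A tape is two-way infinite with finitely many nonblank cells. -/
structure Cfg where
  state : M.Q
  tapes : M.ι → Turing.Tape (Option (Bool ⊕ M.A))

/-- Moving the head of a tape. -/
def moveHead {Γ : Type} [Inhabited Γ] : Option Turing.Dir → Turing.Tape Γ → Turing.Tape Γ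
  | none, T => T
  | some d, T => T.move d

/-- One step of the computation. -/
def step (c : M.Cfg) : Option M.Cfg :=
  (M.δ c.state fun i => (c.tapes i).head).map fun r =>
    ⟨r.1, fun i => moveHead (r.2 i).2 ((c.tapes i).write (r.2 i).1)⟩

open Classical in
/-- The configuration in state `q` in which the input-output tape holds exactly `w`, scanned at
its first symbol, while all the other tapes are blank. -/
noncomputable def wordCfg (q : M.Q) (w : Word) : M.Cfg :=
  ⟨q, fun i => Turing.Tape.mk₁ (if i = M.io then w.map fun b => some (Sum.inl b) else [])⟩

/-- `M(w) = v`: started on `w` with everything else blank, the machine halts in its final state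
with output `v` and everything else blank. -/
def Computes (w v : Word) : Prop :=
  StateTransition.Reaches M.step (M.wordCfg M.start w) (M.wordCfg M.final v)

/-- A reversible Turing machine: every configuration has at most one predecessor, and the
start state is never entered (the mirror image of the convention that the final state is never
left). -/
def IsReversible : Prop :=
  (∀ c c' d : M.Cfg, M.step c = some d → M.step c' = some d → c = c') ∧
    ∀ q a r, M.δ q a = some r → r.1 ≠ M.start

/-- The irreversibility cost `E_M(x, y) = min {|p| + |q| : M ⟨x, p⟩ = ⟨y, q⟩}` (`⊤` if there are
no such `p, q`). -/
noncomputable def irrevCost (x y : Word) : ℕ∞ :=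
  ⨅ (p : Word) (q : Word) (_ : M.Computes (pair x p) (pair y q)),
    ((p.length + q.length : ℕ) : ℕ∞)

/-- `M` is a reversible machine whose irreversibility cost function is universal: it is minimal,
up to an additive constant, among those of all reversible machines. -/
def IsUniversalReversible : Prop :=
  M.IsReversible ∧ ∀ R : TM, R.IsReversible →
    ∃ c : ℕ, ∀ x y : Word, M.irrevCost x y ≤ R.irrevCost x y + c

end TM

end RevErasure

/-!
Stack programs whose only loops run between a first and a last time that can be recognized from the
current configuration can be run backwards by exchanging pushes and pops, and they translate into
reversible Turing machines. Running a computation, copying its result and running the computation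
backwards (Bennett) shows, by induction on primitive recursive functions, that `y ↦ y + f(x)` is
computed by such a program. Hence so is every partial computable injection with computable partial
inverse: search for an accepting history, and erase the input by running the search for the inverse
backwards.

To erase `x`, let `p` be a canonical shortest program for `x` and `s` a canonical shortest program,
of length `m`, that computes `|p| = C(x)` from `x`. The map `⟨x, s⟩ ↦ ⟨ε, 1^m 0 p⟩` is injective
and computable, so a reversible machine computes it, at the cost `|p| + 2m + 1`. Conversely, a
reversible machine that turns `⟨x, p⟩` into `⟨ε, q⟩` is injective, so `q` determines `x`, and a
search for a halting computation with output `⟨ε, q⟩` recovers `x` from `q`.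
-/

namespace RevErasure

open Function StateTransition

/-! ### Reversible stack programs -/

/-- A store assigns a stack of bits, top first, to every register. -/
abbrev Store (ι : Type) := ι → List Bool

/-- A test asks whether the top of a given stack is a given bit, or (`none`) whether that stack is
empty. -/
abbrev TopTest (ι : Type) := ι × Option Bool

/-- The test succeeds on the store. -/
def TopTest.Holds {ι : Type} (e : TopTest ι) (s : Store ι) : Prop := (s e.1).head? = e.2

/-- Structured reversible programs on stacks. The entry test of a loop makes it invertible: it must
hold when the loop is entered and fail after every round. -/
inductive Prog (ι : Type) : Type
  | push (i : ι) (a : Bool) : Prog ι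
  | pop (i : ι) (a : Bool) : Prog ι
  | seq (P R : Prog ι) : Prog ι
  | loop (entry : TopTest ι) (P : Prog ι) (exit : TopTest ι) : Prog ι

namespace Prog

variable {ι κ : Type}

/-- The program that undoes `P`. -/
def inv : Prog ι → Prog ι
  | push i a => pop i a
  | pop i a => push i a
  | seq P R => seq R.inv P.inv
  | loop e₁ P e₂ => loop e₂ P.inv e₁

/-- The big-step semantics: `P.Exec s s'` says that `P` transforms the store `s` into `s'`. -/
def Exec [DecidableEq ι] : Prog ι → Store ι → Store ι → Prop
  | push i a, s, s' => s' = update s i (a :: s i)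
  | pop i a, s, s' => s = update s' i (a :: s' i)
  | seq P R, s, s' => ∃ t, P.Exec s t ∧ R.Exec t s'
  | loop e₁ P e₂, s, s' => e₁.Holds s ∧ e₂.Holds s' ∧
      Relation.ReflTransGen (fun a b => ¬ e₂.Holds a ∧ P.Exec a b ∧ ¬ e₁.Holds b) s s'

section Exec

variable [DecidableEq ι] [DecidableEq κ]

theorem Exec.inv {P : Prog ι} {s s' : Store ι} (h : P.Exec s s') : P.inv.Exec s' s := by
  induction P generalizing s s' with
  | push i a => exact h
  | pop i a => exact h
  | seq P R ihP ihR =>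
    obtain ⟨t, hP, hR⟩ := h
    exact ⟨t, ihR hR, ihP hP⟩
  | loop e₁ P e₂ ih =>
    obtain ⟨hentry, hexit, hrounds⟩ := h
    exact ⟨hexit, hentry, hrounds.swap.lift id fun a b ⟨hb, hP, ha⟩ => ⟨ha, ih hP, hb⟩⟩

theorem Exec.seq {P R : Prog ι} {s t s' : Store ι} (hP : P.Exec s t) (hR : R.Exec t s') :
    (P.seq R).Exec s s' :=
  ⟨t, hP, hR⟩

theorem Exec.conj {P R : Prog ι} {s t s' t' : Store ι} (hs : P.Exec s t) (hR : R.Exec t t')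
    (hs' : P.Exec s' t') : (P.seq (R.seq P.inv)).Exec s s' :=
  hs.seq (hR.seq hs'.inv)

theorem exec_loop {e₁ e₂ : TopTest ι} {P : Prog ι} (σ : ℕ → Store ι) (k : ℕ)
    (hentry : e₁.Holds (σ 0)) (hentry' : ∀ j < k, ¬ e₁.Holds (σ (j + 1)))
    (hexit : e₂.Holds (σ k)) (hexit' : ∀ j < k, ¬ e₂.Holds (σ j))
    (hP : ∀ j < k, P.Exec (σ j) (σ (j + 1))) : (loop e₁ P e₂).Exec (σ 0) (σ k) := by
  refine ⟨hentry, hexit, ?_⟩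
  suffices ∀ j ≤ k, Relation.ReflTransGen
      (fun a b => ¬ e₂.Holds a ∧ P.Exec a b ∧ ¬ e₁.Holds b) (σ 0) (σ j) from this k le_rfl
  intro j
  induction j with
  | zero => exact fun _ => .refl
  | succ j ih => exact fun hj => (ih (by lia)).tail ⟨hexit' j hj, hP j hj, hentry' j hj⟩

/-- The program with its registers renamed along `f`. -/
def map (f : κ → ι) : Prog κ → Prog ι
  | push i a => push (f i) a
  | pop i a => pop (f i) a
  | seq P R => seq (P.map f) (R.map f)
  | loop e₁ P e₂ => loop (f e₁.1, e₁.2) (P.map f) (f e₂.1, e₂.2)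

theorem Exec.of_map {f : κ → ι} (hf : Injective f) {P : Prog κ} {s s' : Store ι}
    (h : (P.map f).Exec s s') : P.Exec (s ∘ f) (s' ∘ f) := by
  induction P generalizing s s' with
  | push i a =>
    obtain rfl : s' = _ := h
    exact update_comp_eq_of_injective s hf i _
  | pop i a =>
    obtain rfl : s = _ := h
    exact update_comp_eq_of_injective s' hf i _
  | seq P R ihP ihR =>
    obtain ⟨t, hP, hR⟩ := h
    exact ⟨t ∘ f, ihP hP, ihR hR⟩
  | loop e₁ P e₂ ih =>
    obtain ⟨hentry, hexit, hrounds⟩ := h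
    exact ⟨hentry, hexit, hrounds.lift (· ∘ f) fun a b ⟨ha, hP, hb⟩ => ⟨ha, ih hP, hb⟩⟩

end Exec

theorem eventually_exists_map_val_eq (P : Prog ℕ) :
    ∀ᶠ K in Filter.atTop, ∃ P' : Prog (Fin K), P'.map Fin.val = P := by
  induction P with
  | push i a =>
    filter_upwards [Filter.eventually_gt_atTop i] with K hi using ⟨push ⟨i, hi⟩ a, rfl⟩
  | pop i a =>
    filter_upwards [Filter.eventually_gt_atTop i] with K hi using ⟨pop ⟨i, hi⟩ a, rfl⟩
  | seq P R ihP ihR =>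
    filter_upwards [ihP, ihR]
    rintro K ⟨P', rfl⟩ ⟨R', rfl⟩
    exact ⟨P'.seq R', rfl⟩
  | loop e₁ P e₂ ih =>
    filter_upwards [ih, Filter.eventually_gt_atTop e₁.1, Filter.eventually_gt_atTop e₂.1]
    rintro K ⟨P', rfl⟩ h₁ h₂
    exact ⟨loop (⟨e₁.1, h₁⟩, e₁.2) P' (⟨e₂.1, h₂⟩, e₂.2), rfl⟩

end Prog

/-! ### Reversible Turing machines from stack programs -/

/-- Tape symbols: blanks and bits. -/
abbrev Sym := Option (Bool ⊕ Empty)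

/-- Every tape `T i` is rewritten and its head moved according to `r i`. -/
def act {ι : Type} (r : ι → Sym × Option Turing.Dir) (T : ι → Turing.Tape Sym) :
    ι → Turing.Tape Sym :=
  fun i => TM.moveHead (r i).2 ((T i).write (r i).1)

/-- The action that writes `b` on tape `i`, moves its head by `d`, and leaves the other tapes, whose
scanned symbols are given by `h`, as they are. -/
def actOn {ι : Type} [DecidableEq ι] (i : ι) (b : Sym) (d : Option Turing.Dir) (h : ι → Sym) :
    ι → Sym × Option Turing.Dir :=
  update (fun j => (h j, none)) i (b, d)

theorem act_idle {ι : Type} (T : ι → Turing.Tape Sym) : act (fun i => ((T i).head, none)) T = T :=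
  funext fun i => (T i).write_self

theorem act_actOn {ι : Type} [DecidableEq ι] (i : ι) (b : Sym) (d : Option Turing.Dir)
    (T : ι → Turing.Tape Sym) :
    act (actOn i b d fun j => (T j).head) T = update T i (TM.moveHead d ((T i).write b)) := by
  funext j
  obtain rfl | hj := eq_or_ne j i
  · simp [act, actOn]
  · simp [act, actOn, hj, TM.moveHead]

theorem eq_of_update_eq {α : Type*} {β : α → Type*} [DecidableEq α] {f g : ∀ a, β a} {a : α}
    {x y : β a} (h : update f a x = update g a y) (h' : x = y → f a = g a) : f = g := by
  funext b
  obtain rfl | hb := eq_or_ne b a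
  · exact h' (by simpa using congrFun h b)
  · simpa [hb] using congrFun h b

theorem eq_of_head_eq_of_write_eq {Γ : Type*} [Inhabited Γ] {T T' : Turing.Tape Γ} {b : Γ}
    (hhead : T.head = T'.head) (hwrite : T.write b = T'.write b) : T = T' := by
  rw [← T.write_self, ← T'.write_self, hhead]
  simpa [Turing.Tape.write] using hwrite

/-- The test succeeds on the scanned symbols. -/
def TopTest.HoldsHeads {ι : Type} (e : TopTest ι) (h : ι → Sym) : Prop := h e.1 = e.2.map Sum.inl

/-- A control unit with states `Q` for a machine with tapes indexed by `ι`. -/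
structure Control (ι Q : Type) where
  start : Q
  final : Q
  δ : Q → (ι → Sym) → Option (Q × (ι → Sym × Option Turing.Dir))

namespace Control

variable {ι Q Q' : Type}

/-- One step of a control unit, on pairs of a state and the contents of the tapes. -/
def step (M : Control ι Q) (c : Q × (ι → Turing.Tape Sym)) : Option (Q × (ι → Turing.Tape Sym)) :=
  (M.δ c.1 fun i => (c.2 i).head).map fun r => (r.1, act r.2 c.2)

/-- Reversibility of a control unit: the final state is never left, the start state is never
entered, and every configuration has at most one predecessor. -/
structure IsReversible (M : Control ι Q) : Prop where
  step_final (T : ι → Turing.Tape Sym) : M.step (M.final, T) = none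
  ne_start {c d : Q × (ι → Turing.Tape Sym)} (h : M.step c = some d) : d.1 ≠ M.start
  step_inj {c c' d : Q × (ι → Turing.Tape Sym)} (h : M.step c = some d)
    (h' : M.step c' = some d) : c = c'

/-- Started on the tapes `T`, the control unit reaches its final state with the tapes `T'`. -/
def Runs (M : Control ι Q) (T T' : ι → Turing.Tape Sym) : Prop :=
  Reaches M.step (M.start, T) (M.final, T')

/-- The tapes holding the stacks of a store, with the heads on the tops. -/
def stackTapes (s : Store ι) : ι → Turing.Tape Sym :=
  fun i => Turing.Tape.mk₁ ((s i).map fun b => some (Sum.inl b))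

theorem head_stackTapes (s : Store ι) (i : ι) :
    (stackTapes s i).head = (s i).head?.map Sum.inl := by
  cases h : s i <;> simp only [stackTapes, h] <;> rfl

theorem stackTapes_update [DecidableEq ι] (s : Store ι) (i : ι) (l : List Bool) :
    stackTapes (update s i l) =
      update (stackTapes s) i (Turing.Tape.mk₁ (l.map fun b => some (Sum.inl b))) := by
  funext j
  obtain rfl | hj := eq_or_ne j i
  · simp [stackTapes]
  · simp [stackTapes, hj]

theorem IsReversible.ne_final {M : Control ι Q} (hM : M.IsReversible)
    {c d : Q × (ι → Turing.Tape Sym)} (h : M.step c = some d) : c.1 ≠ M.final := by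
  rintro hc
  have := hM.step_final c.2
  rw [← hc, h] at this
  cases this

theorem IsReversible.δ_final {M : Control ι Q} (hM : M.IsReversible) (a : ι → Sym) :
    M.δ M.final a = none := by
  simpa [step, Turing.Tape.mk₁, Turing.Tape.mk₂] using
    hM.step_final fun i => Turing.Tape.mk₁ [a i]

theorem IsReversible.fst_ne_start {M : Control ι Q} (hM : M.IsReversible) {q : Q} {a : ι → Sym}
    {r : Q × (ι → Sym × Option Turing.Dir)} (h : M.δ q a = some r) : r.1 ≠ M.start := by
  let T : ι → Turing.Tape Sym := fun i => Turing.Tape.mk₁ [a i]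
  have hstep : M.step (q, T) = some (r.1, act r.2 T) := by
    simp [step, T, h, Turing.Tape.mk₁, Turing.Tape.mk₂]
  exact hM.ne_start hstep

/-- Pushing `a` on the stack of tape `i`: the head moves to the left, then writes on the blank. -/
def push [DecidableEq ι] (i : ι) (a : Bool) : Control ι (Fin 3) where
  start := 0
  final := 2
  δ
    | 0, h => some (1, actOn i (h i) (some .left) h)
    | 1, h => if h i = none then some (2, actOn i (some (.inl a)) none h) else none
    | 2, _ => none

theorem push_step_eq_some_iff [DecidableEq ι] {i : ι} {a : Bool}
    {c d : Fin 3 × (ι → Turing.Tape Sym)} :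
    (push i a).step c = some d ↔
      (∃ T, c = (0, T) ∧ d = (1, update T i ((T i).move .left))) ∨
      ∃ T, (T i).head = none ∧ c = (1, T) ∧ d = (2, update T i ((T i).write (some (.inl a)))) := by
  obtain ⟨q, T⟩ := c
  fin_cases q
  · simp [step, push, act_actOn, TM.moveHead, eq_comm]
  · by_cases h : (T i).head = none
    · simp [step, push, h, act_actOn, TM.moveHead, eq_comm]
    · simp [step, push, h]
  · simp [step, push]

theorem isReversible_push [DecidableEq ι] (i : ι) (a : Bool) : (push i a).IsReversible where
  step_final T := rfl
  ne_start h := by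
    obtain ⟨T, rfl, rfl⟩ | ⟨T, -, rfl, rfl⟩ := push_step_eq_some_iff.1 h
    · exact (by decide : (1 : Fin 3) ≠ 0)
    · exact (by decide : (2 : Fin 3) ≠ 0)
  step_inj h h' := by
    obtain ⟨T, rfl, rfl⟩ | ⟨T, hT, rfl, rfl⟩ := push_step_eq_some_iff.1 h <;>
    obtain ⟨T', rfl, hd⟩ | ⟨T', hT', rfl, hd⟩ := push_step_eq_some_iff.1 h' <;>
    simp only [Prod.mk.injEq, true_and, Fin.reduceEq, false_and] at hd ⊢
    · exact eq_of_update_eq hd fun hm => LeftInverse.injective Turing.Tape.move_left_right hm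
    · exact eq_of_update_eq hd fun hw => eq_of_head_eq_of_write_eq (hT.trans hT'.symm) hw

theorem push_runs [DecidableEq ι] (i : ι) (a : Bool) (s : Store ι) :
    (push i a).Runs (stackTapes s) (stackTapes (update s i (a :: s i))) := by
  refine .head (push_step_eq_some_iff.2 (.inl ⟨_, rfl, rfl⟩))
    (.single (push_step_eq_some_iff.2 (.inr ⟨_, ?_, rfl, ?_⟩)))
  · rw [update_self]
    rfl
  · simp [stackTapes_update, stackTapes, push, Turing.Tape.mk₁, Turing.Tape.mk₂]

/-- Popping `a` from the stack of tape `i`: the head erases and then moves to the right. -/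
def pop [DecidableEq ι] (i : ι) (a : Bool) : Control ι Bool where
  start := false
  final := true
  δ
    | false, h => if h i = some (.inl a) then some (true, actOn i none (some .right) h) else none
    | true, _ => none

theorem pop_step_eq_some_iff [DecidableEq ι] {i : ι} {a : Bool}
    {c d : Bool × (ι → Turing.Tape Sym)} :
    (pop i a).step c = some d ↔ ∃ T, (T i).head = some (.inl a) ∧ c = (false, T) ∧
      d = (true, update T i (((T i).write none).move .right)) := by
  obtain ⟨_ | _, T⟩ := c
  · by_cases h : (T i).head = some (.inl a)
    · simp [step, pop, h, act_actOn, TM.moveHead, eq_comm]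
    · simp [step, pop, h]
  · simp [step, pop]

theorem isReversible_pop [DecidableEq ι] (i : ι) (a : Bool) : (pop i a).IsReversible where
  step_final T := rfl
  ne_start h := by
    obtain ⟨T, -, rfl, rfl⟩ := pop_step_eq_some_iff.1 h
    exact Bool.true_eq_false_eq_False
  step_inj h h' := by
    obtain ⟨T, hT, rfl, rfl⟩ := pop_step_eq_some_iff.1 h
    obtain ⟨T', hT', rfl, hd⟩ := pop_step_eq_some_iff.1 h'
    simp only [Prod.mk.injEq, true_and] at hd ⊢
    exact eq_of_update_eq hd fun hw => eq_of_head_eq_of_write_eq (hT.trans hT'.symm)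
      (LeftInverse.injective Turing.Tape.move_right_left hw)

theorem pop_runs [DecidableEq ι] (i : ι) (a : Bool) (s : Store ι) :
    (pop i a).Runs (stackTapes (update s i (a :: s i))) (stackTapes s) := by
  have write_none : (Turing.Tape.mk₁ ((a :: s i).map fun b => (some (Sum.inl b) : Sym))).write
      none = (stackTapes s i).move .left := by
    simp only [stackTapes, Turing.Tape.mk₁, Turing.Tape.mk₂, Turing.Tape.write_mk',
      Turing.Tape.move_left_mk', List.map_cons, Turing.ListBlank.tail_mk,
      Turing.ListBlank.head_mk, Turing.ListBlank.cons_mk, List.tail_cons, List.tail_nil]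
    rfl
  refine .single (pop_step_eq_some_iff.2 ⟨_, ?_, rfl, ?_⟩)
  · simp [head_stackTapes]
  · rw [stackTapes_update, update_self, write_none, Turing.Tape.move_left_right, update_idem,
      update_eq_self]
    rfl

theorem Runs.reaches_map {M : Control ι Q} {N : Control ι Q'} {f : Q → Q'}
    (h : ∀ b b', M.step b = some b' → N.step (b.map f id) = some (b'.map f id))
    {T T' : ι → Turing.Tape Sym} (hT : M.Runs T T') :
    Reaches N.step (f M.start, T) (f M.final, T') :=
  Relation.ReflTransGen.lift (Prod.map f id) h _ _ hT

/-- Running one control unit after another. -/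
noncomputable def seq (M : Control ι Q) (N : Control ι Q') : Control ι (Q ⊕ Q') where
  start := .inl M.start
  final := .inr N.final
  δ := open Classical in fun
    | .inl q, h => if q = M.final then some (.inr N.start, fun i => (h i, none))
        else (M.δ q h).map fun r => (.inl r.1, r.2)
    | .inr q, h => (N.δ q h).map fun r => (.inr r.1, r.2)

theorem seq_step_inl {M : Control ι Q} (N : Control ι Q') {c : Q × (ι → Turing.Tape Sym)}
    (hc : c.1 ≠ M.final) :
    (seq M N).step (c.map .inl id) = (M.step c).map (Prod.map .inl id) := by
  simp [step, seq, hc, comp_def]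

theorem seq_step_final (M : Control ι Q) (N : Control ι Q') (T : ι → Turing.Tape Sym) :
    (seq M N).step (.inl M.final, T) = some (.inr N.start, T) := by
  simp [step, seq, act_idle]

theorem seq_step_inr (M : Control ι Q) (N : Control ι Q') (c : Q' × (ι → Turing.Tape Sym)) :
    (seq M N).step (c.map .inr id) = (N.step c).map (Prod.map .inr id) := by
  simp [step, seq, comp_def]

theorem seq_step_eq_some {M : Control ι Q} {N : Control ι Q'}
    {c d : (Q ⊕ Q') × (ι → Turing.Tape Sym)} (h : (seq M N).step c = some d) :
    (∃ b b', M.step b = some b' ∧ c = b.map .inl id ∧ d = b'.map .inl id) ∨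
    (∃ T, c = (.inl M.final, T) ∧ d = (.inr N.start, T)) ∨
    ∃ b b', N.step b = some b' ∧ c = b.map .inr id ∧ d = b'.map .inr id := by
  obtain ⟨q | q, T⟩ := c
  · obtain rfl | hq := eq_or_ne q M.final
    · exact .inr (.inl ⟨T, rfl, (Option.some.inj ((seq_step_final M N T).symm.trans h)).symm⟩)
    · obtain ⟨b', hb', rfl⟩ :=
        Option.map_eq_some_iff.1 ((seq_step_inl N (c := (q, T)) hq).symm.trans h)
      exact .inl ⟨(q, T), b', hb', rfl, rfl⟩
  · obtain ⟨b', hb', rfl⟩ := Option.map_eq_some_iff.1 ((seq_step_inr M N (q, T)).symm.trans h)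
    exact .inr (.inr ⟨(q, T), b', hb', rfl, rfl⟩)

theorem IsReversible.seq {M : Control ι Q} {N : Control ι Q'} (hM : M.IsReversible)
    (hN : N.IsReversible) : (M.seq N).IsReversible where
  step_final T := by
    have h := seq_step_inr M N (N.final, T)
    rwa [hN.step_final] at h
  ne_start h := by
    obtain ⟨b, b', hb, rfl, rfl⟩ | ⟨T, rfl, rfl⟩ | ⟨b, b', -, rfl, rfl⟩ := seq_step_eq_some h
    · exact fun hd => hM.ne_start hb (Sum.inl_injective hd)
    · exact Sum.inr_ne_inl
    · exact Sum.inr_ne_inl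
  step_inj h h' := by
    obtain ⟨b, b', hb, rfl, rfl⟩ | ⟨T, rfl, rfl⟩ | ⟨b, b', hb, rfl, rfl⟩ := seq_step_eq_some h <;>
    obtain ⟨c, c', hc, rfl, hd⟩ | ⟨T', rfl, hd⟩ | ⟨c, c', hc, rfl, hd⟩ := seq_step_eq_some h' <;>
    simp only [Prod.ext_iff, Prod.map, id, Sum.inl.injEq, Sum.inr.injEq, reduceCtorEq, false_and,
      true_and] at hd ⊢
    · rw [hM.step_inj hb (hc.trans (congrArg some (Prod.ext hd.1.symm hd.2.symm)))]
      exact ⟨rfl, rfl⟩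
    · exact hd
    · exact absurd hd.1.symm (hN.ne_start hc)
    · exact absurd hd.1 (hN.ne_start hb)
    · rw [hN.step_inj hb (hc.trans (congrArg some (Prod.ext hd.1.symm hd.2.symm)))]
      exact ⟨rfl, rfl⟩

theorem Runs.seq {M : Control ι Q} {N : Control ι Q'} (hM : M.IsReversible)
    {T T' T'' : ι → Turing.Tape Sym} (h : M.Runs T T') (h' : N.Runs T' T'') :
    (M.seq N).Runs T T'' := by
  have left : Reaches (M.seq N).step (.inl M.start, T) (.inl M.final, T') :=
    h.reaches_map fun b b' hb => by rw [seq_step_inl N (hM.ne_final hb), hb]; rfl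
  have right : Reaches (M.seq N).step (.inr N.start, T') (.inr N.final, T'') :=
    h'.reaches_map fun b b' hb => by rw [seq_step_inr, hb]; rfl
  exact (left.tail (seq_step_final M N T')).trans right

theorem holdsHeads_stackTapes {e : TopTest ι} {s : Store ι} :
    e.HoldsHeads (fun i => (stackTapes s i).head) ↔ e.Holds s := by
  rw [TopTest.HoldsHeads, head_stackTapes, (Option.map_injective Sum.inl_injective).eq_iff,
    TopTest.Holds]

/-- Iterating a control unit between the tests `e₁` and `e₂`. Of the three additional states, `0`
checks the entry test, `1` checks the exit test, and `2` is final. -/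
noncomputable def loop (M : Control ι Q) (e₁ e₂ : TopTest ι) :
    Control ι (Q ⊕ Fin 3) where
  start := .inr 0
  final := .inr 2
  δ := open Classical in fun
    | .inl q, h =>
        if q = M.final then
          if e₁.HoldsHeads h then none else some (.inr 1, fun i => (h i, none))
        else (M.δ q h).map fun r => (.inl r.1, r.2)
    | .inr 0, h => if e₁.HoldsHeads h then some (.inr 1, fun i => (h i, none)) else none
    | .inr 1, h => some (if e₂.HoldsHeads h then .inr 2 else .inl M.start, fun i => (h i, none))
    | .inr 2, _ => none

section loop

variable {e₁ e₂ : TopTest ι} {M : Control ι Q} {T : ι → Turing.Tape Sym}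

theorem loop_step_inl {c : Q × (ι → Turing.Tape Sym)} (hc : c.1 ≠ M.final) :
    (M.loop e₁ e₂).step (c.map .inl id) = (M.step c).map (Prod.map .inl id) := by
  simp [step, loop, hc, comp_def]

theorem loop_step_zero (h : e₁.HoldsHeads fun i => (T i).head) :
    (M.loop e₁ e₂).step (.inr 0, T) = some (.inr 1, T) := by
  simp [step, loop, h, act_idle]

theorem loop_step_final (h : ¬ e₁.HoldsHeads fun i => (T i).head) :
    (M.loop e₁ e₂).step (.inl M.final, T) = some (.inr 1, T) := by
  simp [step, loop, h, act_idle]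

theorem loop_step_one_of_holds (h : e₂.HoldsHeads fun i => (T i).head) :
    (M.loop e₁ e₂).step (.inr 1, T) = some (.inr 2, T) := by
  simp [step, loop, h, act_idle]

theorem loop_step_one_of_not_holds (h : ¬ e₂.HoldsHeads fun i => (T i).head) :
    (M.loop e₁ e₂).step (.inr 1, T) = some (.inl M.start, T) := by
  simp [step, loop, h, act_idle]

theorem loop_step_eq_some {c d : (Q ⊕ Fin 3) × (ι → Turing.Tape Sym)}
    (h : (M.loop e₁ e₂).step c = some d) :
    (∃ b b', M.step b = some b' ∧ c = b.map .inl id ∧ d = b'.map .inl id) ∨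
    (∃ T, (e₁.HoldsHeads fun i => (T i).head) ∧ c = (.inr 0, T) ∧ d = (.inr 1, T)) ∨
    (∃ T, (¬ e₁.HoldsHeads fun i => (T i).head) ∧ c = (.inl M.final, T) ∧ d = (.inr 1, T)) ∨
    ∃ T, c = (.inr 1, T) ∧ (d = (.inr 2, T) ∨ d = (.inl M.start, T)) := by
  obtain ⟨q | q, T⟩ := c
  · obtain rfl | hq := eq_or_ne q M.final
    · by_cases h₁ : e₁.HoldsHeads fun i => (T i).head
      · simp [step, loop, h₁] at h
      · exact .inr (.inr (.inl ⟨T, h₁, rfl,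
          (Option.some.inj ((loop_step_final h₁).symm.trans h)).symm⟩))
    · obtain ⟨b', hb', rfl⟩ :=
        Option.map_eq_some_iff.1 ((loop_step_inl (c := (q, T)) hq).symm.trans h)
      exact .inl ⟨(q, T), b', hb', rfl, rfl⟩
  · fin_cases q
    · by_cases h₁ : e₁.HoldsHeads fun i => (T i).head
      · exact .inr (.inl ⟨T, h₁, rfl, (Option.some.inj ((loop_step_zero h₁).symm.trans h)).symm⟩)
      · simp [step, loop, h₁] at h
    · refine .inr (.inr (.inr ⟨T, rfl, ?_⟩))
      by_cases h₂ : e₂.HoldsHeads fun i => (T i).head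
      · exact .inl (Option.some.inj ((loop_step_one_of_holds h₂).symm.trans h)).symm
      · exact .inr (Option.some.inj ((loop_step_one_of_not_holds h₂).symm.trans h)).symm
    · cases h

theorem IsReversible.loop (hM : M.IsReversible) : (M.loop e₁ e₂).IsReversible where
  step_final T := rfl
  ne_start {_ d} h := by
    change d.1 ≠ .inr 0
    obtain ⟨b, b', -, rfl, rfl⟩ | ⟨T, -, rfl, rfl⟩ | ⟨T, -, rfl, rfl⟩ | ⟨T, rfl, rfl | rfl⟩ :=
      loop_step_eq_some h <;> simp
  step_inj h h' := by
    obtain ⟨b, b', hb, rfl, rfl⟩ | ⟨T, hT, rfl, rfl⟩ | ⟨T, hT, rfl, rfl⟩ | ⟨T, rfl, rfl | rfl⟩ :=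
      loop_step_eq_some h <;>
    obtain ⟨c, c', hc, rfl, hd⟩ | ⟨T', hT', rfl, hd⟩ | ⟨T', hT', rfl, hd⟩ |
      ⟨T', rfl, hd | hd⟩ := loop_step_eq_some h' <;>
    simp only [Prod.ext_iff, Prod.map, id, Sum.inl.injEq, Sum.inr.injEq, reduceCtorEq, false_and,
      true_and, Fin.reduceEq] at hd ⊢
    · rw [hM.step_inj hb (hc.trans (congrArg some (Prod.ext hd.1.symm hd.2.symm)))]
      exact ⟨rfl, rfl⟩
    · exact absurd hd.1 (hM.ne_start hb)
    · exact hd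
    · exact absurd (hd ▸ hT) hT'
    · exact absurd (hd ▸ hT') hT
    · exact hd
    · exact hd
    · exact absurd hd.1.symm (hM.ne_start hc)
    · exact hd

theorem Runs.loop (hM : M.IsReversible) {R : Store ι → Store ι → Prop}
    (hR : ∀ s s', R s s' → M.Runs (stackTapes s) (stackTapes s')) {s s' : Store ι}
    (hentry : e₁.Holds s) (hexit : e₂.Holds s')
    (hrounds : Relation.ReflTransGen (fun a b => ¬ e₂.Holds a ∧ R a b ∧ ¬ e₁.Holds b) s s') :
    (M.loop e₁ e₂).Runs (stackTapes s) (stackTapes s') := by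
  have round (a b : Store ι) (h : ¬ e₂.Holds a ∧ R a b ∧ ¬ e₁.Holds b) :
      Reaches (M.loop e₁ e₂).step (.inr 1, stackTapes a) (.inr 1, stackTapes b) := by
    obtain ⟨ha, hab, hb⟩ := h
    have body : Reaches (M.loop e₁ e₂).step (.inl M.start, stackTapes a)
        (.inl M.final, stackTapes b) :=
      (hR a b hab).reaches_map fun c c' hc => by rw [loop_step_inl (hM.ne_final hc), hc]; rfl
    exact .head (loop_step_one_of_not_holds (holdsHeads_stackTapes.not.2 ha))
      (.tail body (loop_step_final (holdsHeads_stackTapes.not.2 hb)))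
  have rounds : Reaches (M.loop e₁ e₂).step (.inr 1, stackTapes s) (.inr 1, stackTapes s') :=
    Relation.ReflTransGen.lift' (fun a : Store ι => (Sum.inr 1, stackTapes a)) round _ _ hrounds
  exact .head (loop_step_zero (holdsHeads_stackTapes.2 hentry))
    (.tail rounds (loop_step_one_of_holds (holdsHeads_stackTapes.2 hexit)))

end loop

end Control

namespace Prog

variable {ι : Type}

/-- The states of the control unit of a program. -/
def State : Prog ι → Type
  | push _ _ => Fin 3
  | pop _ _ => Bool
  | seq P R => P.State ⊕ R.State
  | loop _ P _ => P.State ⊕ Fin 3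

instance finite_state (P : Prog ι) : Finite P.State := by
  induction P with
  | push i a => exact inferInstanceAs (Finite (Fin 3))
  | pop i a => exact inferInstanceAs (Finite Bool)
  | seq P R ihP ihR => exact inferInstanceAs (Finite (P.State ⊕ R.State))
  | loop e₁ P e₂ ih => exact inferInstanceAs (Finite (P.State ⊕ Fin 3))

variable [DecidableEq ι]

/-- The control unit of the machine that runs a program, holding every stack on a tape. -/
noncomputable def control : (P : Prog ι) → Control ι P.State
  | push i a => Control.push i a
  | pop i a => Control.pop i a
  | seq P R => P.control.seq R.control
  | loop e₁ P e₂ => P.control.loop e₁ e₂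

theorem isReversible_control (P : Prog ι) : P.control.IsReversible := by
  induction P with
  | push i a => exact Control.isReversible_push i a
  | pop i a => exact Control.isReversible_pop i a
  | seq P R ihP ihR => exact ihP.seq ihR
  | loop e₁ P e₂ ih => exact ih.loop

theorem Exec.control_runs {P : Prog ι} {s s' : Store ι} (h : P.Exec s s') :
    P.control.Runs (Control.stackTapes s) (Control.stackTapes s') := by
  induction P generalizing s s' with
  | push i a =>
    obtain rfl : s' = _ := h
    exact Control.push_runs i a s
  | pop i a =>
    obtain rfl : s = _ := h
    exact Control.pop_runs i a s'
  | seq P R ihP ihR =>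
    obtain ⟨t, hP, hR⟩ := h
    exact (ihP hP).seq P.isReversible_control (ihR hR)
  | loop e₁ P e₂ ih =>
    obtain ⟨hentry, hexit, hrounds⟩ := h
    exact Control.Runs.loop P.isReversible_control (fun _ _ => ih) hentry hexit hrounds

variable [Finite ι]

/-- The multitape machine that runs a program, with input and output in the register `io`. -/
noncomputable def toTM (P : Prog ι) (io : ι) : TM where
  Q := P.State
  ι := ι
  A := Empty
  finQ := inferInstance
  finι := inferInstance
  finA := inferInstance
  start := P.control.start
  final := P.control.final
  io := io
  δ := P.control.δ
  δ_final := P.isReversible_control.δ_final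

theorem toTM_step (P : Prog ι) (io : ι) (c : (P.toTM io).Cfg) :
    (P.toTM io).step c = (P.control.step (c.state, c.tapes)).map fun d => ⟨d.1, d.2⟩ := by
  rw [Control.step, Option.map_map]
  rfl

theorem toTM_isReversible (P : Prog ι) (io : ι) : (P.toTM io).IsReversible := by
  constructor
  · intro c c' d hc hc'
    rw [toTM_step] at hc hc'
    obtain ⟨e, he, rfl⟩ := Option.map_eq_some_iff.1 hc
    obtain ⟨e', he', heq⟩ := Option.map_eq_some_iff.1 hc'
    obtain ⟨hstate, htapes⟩ := TM.Cfg.mk.inj heq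
    obtain rfl : e' = e := Prod.ext hstate htapes
    obtain ⟨hstate, htapes⟩ := Prod.mk.inj (P.isReversible_control.step_inj he he')
    cases c
    cases c'
    simp only [TM.Cfg.mk.injEq]
    exact ⟨hstate, htapes⟩
  · exact fun q a r h => P.isReversible_control.fst_ne_start h

/-- The store that holds `w` in the register `io` and is empty elsewhere. -/
def wordStore {ι : Type} [DecidableEq ι] (io : ι) (w : Word) : Store ι := update (fun _ => []) io w

theorem toTM_wordCfg (P : Prog ι) (io : ι) (q : P.State) (w : Word) :
    (P.toTM io).wordCfg q w = ⟨q, Control.stackTapes (ι := ι) (wordStore io w)⟩ := by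
  refine congrArg (TM.Cfg.mk (M := P.toTM io) q) (funext fun (i : ι) => ?_)
  obtain rfl | hi := eq_or_ne i io
  · simp only [toTM, Control.stackTapes, wordStore, if_true, update_self]
    rfl
  · simp only [toTM, Control.stackTapes, wordStore, hi, if_false, update_of_ne hi]
    rfl

theorem toTM_computes {P : Prog ι} {io : ι} {w v : Word}
    (h : P.Exec (wordStore io w) (wordStore io v)) : (P.toTM io).Computes w v := by
  have start_cfg := P.toTM_wordCfg io P.control.start w
  have final_cfg := P.toTM_wordCfg io P.control.final v
  change Reaches _ ((P.toTM io).wordCfg P.control.start w) ((P.toTM io).wordCfg P.control.final v)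
  rw [start_cfg, final_cfg]
  refine Relation.ReflTransGen.lift
    (fun c : P.State × (ι → Turing.Tape Sym) => (⟨c.1, c.2⟩ : (P.toTM io).Cfg))
    (fun c d (hcd : P.control.step c = some d) => ?_) _ _ h.control_runs
  change (P.toTM io).step _ = _
  rw [toTM_step, hcd]
  rfl

theorem exists_isReversible_computes (P : Prog ℕ) : ∃ R : TM, R.IsReversible ∧
    ∀ w v, P.Exec (wordStore 0 w) (wordStore 0 v) → R.Computes w v := by
  obtain ⟨K, ⟨P', rfl⟩, hK⟩ :=
    (P.eventually_exists_map_val_eq.and (Filter.eventually_gt_atTop 0)).exists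
  have wordStore_comp_val (w : Word) : wordStore 0 w ∘ Fin.val = wordStore (⟨0, hK⟩ : Fin K) w :=
    update_comp_eq_of_injective _ Fin.val_injective ⟨0, hK⟩ w
  refine ⟨P'.toTM ⟨0, hK⟩, P'.toTM_isReversible _, fun w v h => toTM_computes ?_⟩
  simpa only [wordStore_comp_val] using h.of_map Fin.val_injective

end Prog

/-! ### Arithmetic by stack programs -/

/-- The unary representation of a number as a stack. -/
def num (n : ℕ) : List Bool := List.replicate n true

@[simp] theorem num_zero : num 0 = [] := rfl

theorem num_succ (n : ℕ) : num (n + 1) = true :: num n := rfl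

@[simp] theorem num_eq_nil_iff {n : ℕ} : num n = [] ↔ n = 0 := List.replicate_eq_nil_iff _

theorem num_sub_eq_cons {j n : ℕ} (h : j < n) : num (n - j) = true :: num (n - (j + 1)) := by
  rw [← num_succ]
  congr 1
  lia

/-- The store whose registers from `b` on hold the stacks of `l`, followed by empty ones, and whose
registers below `b` are those of `s`. -/
def withScratch (b : ℕ) (l : List (List Bool)) (s : Store ℕ) : Store ℕ :=
  fun j => if j < b then s j else l.getD (j - b) []

section withScratch

variable {b j k : ℕ} {a x : List Bool} {l : List (List Bool)} {s : Store ℕ}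

theorem withScratch_of_lt (h : j < b) : withScratch b l s j = s j := if_pos h

@[simp] theorem withScratch_add : withScratch b l s (b + k) = l.getD k [] := by simp [withScratch]

@[simp] theorem withScratch_self : withScratch b l s b = l.headD [] := by
  cases l <;> simp [withScratch]

theorem update_withScratch_of_lt (h : j < b) :
    update (withScratch b l s) j x = withScratch b l (update s j x) := by
  funext r
  simp only [withScratch, update_apply]
  split_ifs <;> first | rfl | lia

theorem update_withScratch_add (h : k < l.length) :
    update (withScratch b l s) (b + k) x = withScratch b (l.set k x) s := by
  funext r
  simp only [withScratch, update_apply, List.getD_eq_getElem?_getD, List.getElem?_set]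
  split_ifs <;> first | rfl | lia

@[simp] theorem update_withScratch_cons_self :
    update (withScratch b (a :: l) s) b x = withScratch b (x :: l) s :=
  update_withScratch_add (k := 0) (by simp)

@[simp] theorem withScratch_append_nil : withScratch b (l ++ [[]]) s = withScratch b l s := by
  funext r
  simp only [withScratch, List.getD_eq_getElem?_getD, List.getElem?_append]
  split_ifs <;> simp_all

theorem update_withScratch_length :
    update (withScratch b l s) (b + l.length) x = withScratch b (l ++ [x]) s := by
  rw [← withScratch_append_nil, update_withScratch_add (by simp)]
  simp

theorem withScratch_withScratch (h : l.length ≤ k) :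
    withScratch (b + k) [] (withScratch b l s) = withScratch b l s := by
  funext r
  simp only [withScratch]
  split_ifs with h₁ h₂ <;> first | rfl | lia | skip
  rw [List.getD_eq_default l _ (by lia)]
  rfl

end withScratch

namespace Prog

theorem exec_push {i : ℕ} {a : Bool} {s s' : Store ℕ} (h : s' = update s i (a :: s i)) :
    (push i a).Exec s s' :=
  h

theorem exec_pop {i : ℕ} {a : Bool} {l : List Bool} {s s' : Store ℕ} (h : s i = a :: l)
    (h' : s' = update s i l) : (pop i a).Exec s s' := by
  subst h'
  simp [Exec, ← h]

/-- The program that does nothing. -/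
def skip : Prog ℕ := (push 0 true).seq (pop 0 true)

theorem exec_skip (s : Store ℕ) : skip.Exec s s :=
  (exec_push rfl).seq (exec_pop (l := s 0) (by simp) (by simp))

/-- Moving the number in register `x` to the empty register `t`. -/
def move (x t : ℕ) : Prog ℕ := loop (t, none) ((pop x true).seq (push t true)) (x, none)

theorem exec_move {x t n : ℕ} (hxt : x ≠ t) {s : Store ℕ} (hx : s x = num n) (ht : s t = []) :
    (move x t).Exec s (update (update s x []) t (num n)) := by
  have hloop := exec_loop (e₁ := (t, none)) (e₂ := (x, none)) (P := (pop x true).seq (push t true))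
    (fun j => update (update s x (num (n - j))) t (num j)) n (by simp [TopTest.Holds])
    (by simp [TopTest.Holds]) (by simp [TopTest.Holds, hxt])
    (fun j hj => by simp [TopTest.Holds, hxt]; lia)
    (fun j hj => (exec_pop (l := num (n - (j + 1))) (by simp [hxt, num_sub_eq_cons hj]) rfl).seq
      (exec_push (by funext r; grind [num_succ])))
  have hzero : update (update s x (num n)) t [] = s := by funext r; grind
  simpa [move, hzero] using hloop

/-- Adding the number in register `x` to register `o`, with the empty register `t` for help. -/
def copy (x o t : ℕ) : Prog ℕ :=
  (loop (t, none) ((pop x true).seq ((push t true).seq (push o true))) (x, none)).seq (move t x)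

theorem exec_copy {x o t n : ℕ} (hxt : x ≠ t) (hxo : x ≠ o) (hot : o ≠ t) {s : Store ℕ}
    (hx : s x = num n) (ht : s t = []) : (copy x o t).Exec s (update s o (num n ++ s o)) := by
  have hloop := exec_loop (e₁ := (t, none)) (e₂ := (x, none))
    (P := (pop x true).seq ((push t true).seq (push o true)))
    (fun j => update (update (update s x (num (n - j))) t (num j)) o (num j ++ s o)) n
    (by simp [TopTest.Holds, hot.symm]) (by simp [TopTest.Holds, hot.symm])
    (by simp [TopTest.Holds, hxt, hxo]) (fun j hj => by simp [TopTest.Holds, hxt, hxo]; lia)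
    (fun j hj => (exec_pop (l := num (n - (j + 1))) (by simp [hxt, hxo, num_sub_eq_cons hj])
      rfl).seq ((exec_push rfl).seq (exec_push (by funext r; grind [num_succ]))))
  have hzero : update (update (update s x (num n)) t []) o (s o) = s := by funext r; grind
  have hmove := exec_move (n := n) hxt.symm
    (s := update (update (update s x []) t (num n)) o (num n ++ s o))
    (by simp [hot.symm]) (by simp [hxt, hxo])
  have hend : update (update (update (update (update s x []) t (num n)) o (num n ++ s o)) t []) x
      (num n) = update s o (num n ++ s o) := by funext r; grind
  exact Exec.seq (by simpa [hzero] using hloop) (hend ▸ hmove)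

/-- `P` adds the value of `f` at the numbers in the registers `xs` to register `o`, provided that
the registers from `b` on are empty. -/
def Implements {n : ℕ} (P : Prog ℕ) (f : List.Vector ℕ n →. ℕ) (xs : Fin n → ℕ) (o b : ℕ) :
    Prop :=
  ∀ (s : Store ℕ) (v : List.Vector ℕ n) (y : ℕ), (∀ i, s (xs i) = num (v.get i)) → y ∈ f v →
    P.Exec (withScratch b [] s) (withScratch b [] (update s o (num y ++ s o)))

/-- Functions that are computed by stack programs, whatever the registers of the arguments and of
the value. -/
def Implementable {n : ℕ} (f : List.Vector ℕ n →. ℕ) : Prop :=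
  ∀ (xs : Fin n → ℕ) (o b : ℕ), (∀ i, xs i < b ∧ xs i ≠ o) → o < b →
    ∃ P : Prog ℕ, P.Implements f xs o b

/-- `L` leaves the value of `f` at the numbers in the registers `xs` in register `b + r`, and
garbage that only depends on these numbers in the `r` registers from `b` on. -/
def ImplementsWithGarbage {n : ℕ} (L : Prog ℕ) (f : List.Vector ℕ n →. ℕ) (xs : Fin n → ℕ)
    (b r : ℕ) : Prop :=
  ∀ (v : List.Vector ℕ n), ∀ y ∈ f v, ∃ l : List (List Bool), l.length = r ∧
    ∀ s : Store ℕ, (∀ i, s (xs i) = num (v.get i)) →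
      L.Exec (withScratch b [] s) (withScratch b (l ++ [num y]) s)

section Implements

variable {m n b o : ℕ} {P L : Prog ℕ} {f : List.Vector ℕ n →. ℕ} {xs : Fin n → ℕ}
  {l : List (List Bool)} {s : Store ℕ} {v : List.Vector ℕ n} {y : ℕ}

theorem Implements.exec_append {r : ℕ} (h : P.Implements f xs (b + r) (b + m))
    (hl : l.length = r) (hr : r < m) (hv : ∀ i, withScratch b l s (xs i) = num (v.get i))
    (hy : y ∈ f v) : P.Exec (withScratch b l s) (withScratch b (l ++ [num y]) s) := by
  subst hl
  have hexec := h (withScratch b l s) v y hv hy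
  rwa [withScratch_withScratch hr.le, withScratch_add, List.getD_eq_default l _ le_rfl,
    List.append_nil, update_withScratch_length, withScratch_withScratch (by simpa)] at hexec

/-- Bennett's trick: compute, copy the value, uncompute. -/
theorem ImplementsWithGarbage.implements {r : ℕ} (h : L.ImplementsWithGarbage f xs b r)
    (hxs : ∀ i, xs i ≠ o) (ho : o < b) :
    (L.seq ((copy (b + r) o (b + (r + 1))).seq L.inv)).Implements f xs o b := by
  intro s v y hv hy
  obtain ⟨l, rfl, hL⟩ := h v y hy
  refine (hL s hv).conj ?_ (hL _ fun i => (update_of_ne (hxs i) _ _).trans (hv i))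
  have hcopy := exec_copy (x := b + l.length) (o := o) (t := b + (l.length + 1)) (n := y)
    (s := withScratch b (l ++ [num y]) s) (by lia) (by lia) (by lia) (by simp) (by simp)
  rwa [withScratch_of_lt ho, update_withScratch_of_lt ho] at hcopy

theorem implementable_zero : Implementable (n := 0) fun _ => Part.some 0 := by
  refine fun xs o b _ _ => ⟨skip, fun s v y _ hy => ?_⟩
  obtain rfl := Part.mem_some_iff.1 hy
  simpa using exec_skip _

theorem implementable_get (i : Fin n) :
    Implementable fun v : List.Vector ℕ n => Part.some (v.get i) := by
  refine fun xs o b hxs ho => ⟨copy (xs i) o b, fun s v y hv hy => ?_⟩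
  obtain rfl := Part.mem_some_iff.1 hy
  have hcopy := exec_copy (n := v.get i) (s := withScratch b [] s) (hxs i).1.ne (hxs i).2 ho.ne
    ((withScratch_of_lt (hxs i).1).trans (hv i)) (by simp)
  rwa [withScratch_of_lt ho, update_withScratch_of_lt ho] at hcopy

theorem implementable_succ : Implementable (n := 1) fun v => Part.some v.head.succ := by
  intro xs o b hxs ho
  obtain ⟨P, hP⟩ := implementable_get (0 : Fin 1) xs o b hxs ho
  refine ⟨P.seq (push o true), fun s v y hv hy => ?_⟩
  obtain rfl := Part.mem_some_iff.1 hy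
  refine (hP s v v.head hv (by simp)).seq (exec_push ?_)
  rw [withScratch_of_lt ho, update_withScratch_of_lt ho]
  simp [num_succ]

end Implements

section comp

variable {m n b : ℕ} {g : Fin m → List.Vector ℕ n →. ℕ}

theorem mem_mOfFn_iff {α : Type*} {n : ℕ} {g : Fin n → Part α} {w : List.Vector α n} :
    w ∈ List.Vector.mOfFn g ↔ ∀ i, w.get i ∈ g i := by
  induction n with
  | zero => simp [List.Vector.mOfFn, Subsingleton.elim w List.Vector.nil]
  | succ n ih =>
    have exists_eq_cons_iff (P : List.Vector α n → Prop) (a : α) :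
        (∃ u, P u ∧ w = a ::ᵥ u) ↔ w.head = a ∧ P w.tail := by
      grind [List.Vector.cons_head_tail, List.Vector.head_cons, List.Vector.tail_cons]
    simp [List.Vector.mOfFn, Fin.forall_fin_succ, ih, exists_eq_cons_iff]

theorem exists_exec_arguments (hg : ∀ i, Implementable (g i)) {xs : Fin n → ℕ}
    (hxs : ∀ i, xs i < b) {k : ℕ} (hk : k ≤ m) : ∃ Q : Prog ℕ, ∀ (s : Store ℕ)
      (v : List.Vector ℕ n) (w : List.Vector ℕ m), (∀ i, s (xs i) = num (v.get i)) →
      (∀ i, w.get i ∈ g i v) →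
      Q.Exec (withScratch b [] s) (withScratch b ((w.toList.take k).map num) s) := by
  induction k with
  | zero => exact ⟨skip, fun s v w _ _ => by simpa using exec_skip _⟩
  | succ k ih =>
    obtain ⟨Q, hQ⟩ := ih (by lia)
    obtain ⟨P, hP⟩ := hg ⟨k, hk⟩ xs (b + k) (b + m) (fun i => by grind) (by lia)
    refine ⟨Q.seq P, fun s v w hv hw => (hQ s v w hv hw).seq ?_⟩
    have hexec := hP.exec_append (s := s) (l := (w.toList.take k).map num) (by simp; lia)
      (by lia) (fun i => (withScratch_of_lt (hxs i)).trans (hv i)) (hw ⟨k, hk⟩)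
    rw [List.take_succ_eq_append_getElem (by simpa)]
    simp only [List.map_append, List.map_cons, List.map_nil]
    exact hexec

theorem implementable_comp {f : List.Vector ℕ m →. ℕ} (hf : Implementable f)
    (hg : ∀ i, Implementable (g i)) :
    Implementable fun v => (List.Vector.mOfFn fun i => g i v) >>= f := by
  intro xs o b hxs ho
  obtain ⟨Q, hQ⟩ := exists_exec_arguments hg (fun i => (hxs i).1) le_rfl
  obtain ⟨P, hP⟩ := hf (fun i => b + i) (b + m) (b + (m + 1)) (by simp; lia) (by lia)
  refine ⟨_, ImplementsWithGarbage.implements (L := Q.seq P) (r := m) ?_ (fun i => (hxs i).2) ho⟩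
  intro v y hy
  obtain ⟨w, hw, hy⟩ := Part.mem_bind_iff.1 hy
  refine ⟨w.toList.map num, by simp, fun s hv => ?_⟩
  have hargs := hQ s v w hv (mem_mOfFn_iff.1 hw)
  rw [List.take_of_length_le (by simp)] at hargs
  refine hargs.seq (hP.exec_append (by simp) (by simp) (fun i => ?_) hy)
  simp [List.Vector.get_eq_get_toList]

end comp

theorem implementable_rfind {n : ℕ} {f : List.Vector ℕ (n + 1) → ℕ}
    (hf : Implementable fun v => Part.some (f v)) :
    Implementable fun v => Nat.rfind fun m => Part.some (f (m ::ᵥ v) = 0) := by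
  intro xs o b hxs ho
  obtain ⟨F, hF⟩ := hf (Fin.cons b xs) (b + 1) (b + 2) (Fin.cases (by simp) fun i => by
    simp only [Fin.cons_succ]; grind) (by lia)
  let search : Prog ℕ := F.seq (loop (b, none) (F.inv.seq ((push b true).seq F)) (b + 1, none))
  refine ⟨_, ImplementsWithGarbage.implements (L := search) (r := 0) ?_ (fun i => (hxs i).2) ho⟩
  intro v y hy
  refine ⟨[], rfl, fun s hv => ?_⟩
  have hF (j : ℕ) : F.Exec (withScratch b [num j] s) (withScratch b [num j, num (f (j ::ᵥ v))] s) :=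
    hF.exec_append (l := [num j]) (v := j ::ᵥ v) rfl (by simp)
      (Fin.cases (by simp) fun i => by simp [withScratch_of_lt (hxs i).1, hv i])
      (Part.mem_some _)
  have hfy : f (y ::ᵥ v) = 0 := by simpa using Nat.rfind_spec hy
  have hloop := exec_loop (e₁ := (b, none)) (e₂ := (b + 1, none))
    (P := F.inv.seq ((push b true).seq F))
    (fun j => withScratch b [num j, num (f (j ::ᵥ v))] s) y (by simp [TopTest.Holds])
    (by simp [TopTest.Holds]) (by simp [TopTest.Holds, hfy])
    (fun j hj => by simpa [TopTest.Holds] using Nat.rfind_min hy hj)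
    (fun j _ => (hF j).inv.seq ((exec_push (by simp [num_succ])).seq (hF (j + 1))))
  have hstart : withScratch b [num 0] s = withScratch b [] s := withScratch_append_nil (l := [])
  have hend : withScratch b [num y, []] s = withScratch b [num y] s :=
    withScratch_append_nil (l := [num y])
  exact Exec.seq (hstart ▸ hF 0) (by simpa only [hfy, num_zero, hend, List.nil_append] using hloop)

/-- The stack of the unary representations of `Y 0, …, Y (j - 1)`, last first, each one on top of a
separator. -/
def history (Y : ℕ → ℕ) : ℕ → List Bool
  | 0 => []
  | j + 1 => num (Y j) ++ false :: history Y j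

/-- Moving the number in register `y` onto a separator on the stack of register `h`. -/
def record (y h : ℕ) : Prog ℕ :=
  (push h false).seq (loop (h, some false) ((pop y true).seq (push h true)) (y, none))

theorem exec_record {y h n : ℕ} (hyh : y ≠ h) {s : Store ℕ} (hy : s y = num n) :
    (record y h).Exec s (update (update s y []) h (num n ++ false :: s h)) := by
  have hloop := exec_loop (e₁ := (h, some false)) (e₂ := (y, none))
    (P := (pop y true).seq (push h true))
    (fun j => update (update s y (num (n - j))) h (num j ++ false :: s h)) n
    (by simp [TopTest.Holds]) (by simp [TopTest.Holds, num_succ])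
    (by simp [TopTest.Holds, hyh]) (fun j hj => by simp [TopTest.Holds, hyh]; lia)
    (fun j hj => (exec_pop (l := num (n - (j + 1))) (by simp [hyh, num_sub_eq_cons hj]) rfl).seq
      (exec_push (by funext r; grind [num_succ])))
  have hzero : update (update s y (num n)) h (false :: s h) = update s h (false :: s h) := by
    funext r; grind
  exact (exec_push rfl).seq (by simpa [hzero] using hloop)

section prec

variable {n b o : ℕ} {g : List.Vector ℕ (n + 2) → ℕ} {F G : Prog ℕ} {xs : Fin (n + 1) → ℕ}

/-- One step of a primitive recursion: the registers `b`, …, `b + 3` hold a countdown, the history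
of the values, the index and the current value. The program `G` adds the next value to the register
`b + 4`. -/
def precStep (G : Prog ℕ) (b : ℕ) : Prog ℕ :=
  G.seq ((record (b + 3) (b + 1)).seq ((move (b + 4) (b + 3)).seq
    ((push (b + 2) true).seq (pop b true))))

theorem exec_precStep (hG : G.Implements (fun v => Part.some (g v))
      (Fin.cons (b + 2) (Fin.cons (b + 3) (Fin.tail xs))) (b + 4) (b + 5))
    (hxs : ∀ i, xs i < b) {s : Store ℕ} {v : List.Vector ℕ (n + 1)}
    (hv : ∀ i, s (xs i) = num (v.get i)) (a y j : ℕ) (l : List Bool) :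
    (precStep G b).Exec (withScratch b [num (a + 1), l, num j, num y] s)
      (withScratch b
        [num a, num y ++ false :: l, num (j + 1), num (g (j ::ᵥ y ::ᵥ v.tail))] s) := by
  have hinput : ∀ i, withScratch b [num (a + 1), l, num j, num y] s
      ((Fin.cons (b + 2) (Fin.cons (b + 3) (Fin.tail xs)) : Fin (n + 2) → ℕ) i) =
        num ((j ::ᵥ y ::ᵥ v.tail).get i) :=
    Fin.cases withScratch_add (Fin.cases withScratch_add
      fun i => by simp [Fin.tail, withScratch_of_lt (hxs _), hv])
  refine (hG.exec_append rfl (by simp) hinput (Part.mem_some _)).seq ?_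
  refine (exec_record (n := y) (by lia) (by simp)).seq ?_
  refine (exec_move (n := g (j ::ᵥ y ::ᵥ v.tail)) (by lia) (by simp [update_withScratch_add])
    (by simp [update_withScratch_add])).seq ?_
  refine (exec_push rfl).seq (exec_pop (l := num a) (by simp [update_withScratch_add, num_succ]) ?_)
  simpa [update_withScratch_add, num_succ] using (withScratch_append_nil (l := [_, _, _, _])).symm

theorem implementable_prec {f : List.Vector ℕ n → ℕ} (hf : Implementable fun v => Part.some (f v))
    (hg : Implementable fun v => Part.some (g v)) :
    Implementable fun v : List.Vector ℕ (n + 1) =>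
      Part.some (v.head.rec (f v.tail) fun j y => g (j ::ᵥ y ::ᵥ v.tail)) := by
  intro xs o b hxs ho
  obtain ⟨F, hF⟩ := hf (Fin.tail xs) (b + 3) (b + 5)
    (fun i => by simp only [Fin.tail]; grind) (by lia)
  obtain ⟨G, hG⟩ := hg (Fin.cons (b + 2) (Fin.cons (b + 3) (Fin.tail xs))) (b + 4) (b + 5)
    (Fin.cases (by simp) (Fin.cases (by simp) fun i => by
      simp only [Fin.cons_succ, Fin.tail]; grind)) (by lia)
  obtain ⟨C, hC⟩ := implementable_get 0 xs b (b + 5) (fun i => by grind) (by lia)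
  let recursion : Prog ℕ := C.seq (F.seq (loop (b + 2, none) (precStep G b) (b, none)))
  refine ⟨_, ImplementsWithGarbage.implements (L := recursion) (r := 3) ?_ (fun i => (hxs i).2) ho⟩
  intro v y hy
  let Y : ℕ → ℕ := Nat.rec (f v.tail) fun j y => g (j ::ᵥ y ::ᵥ v.tail)
  obtain rfl : y = Y v.head := Part.mem_some_iff.1 hy
  refine ⟨[[], history Y v.head, num v.head], rfl, fun s hv => ?_⟩
  have hpad : withScratch b [num v.head, [], []] s = withScratch b [num v.head] s :=
    (withScratch_append_nil (l := [num v.head, []])).trans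
      (withScratch_append_nil (l := [num v.head]))
  have hcopy := hC.exec_append (r := 0) (l := []) (s := s) (v := v) rfl (by simp)
    (fun i => (withScratch_of_lt (hxs i).1).trans (hv i)) (Part.mem_some _)
  rw [List.Vector.get_zero, List.nil_append] at hcopy
  have hbase := hF.exec_append (l := [num v.head, [], []]) (s := s) (v := v.tail) rfl (by simp)
    (fun i => by simp [Fin.tail, withScratch_of_lt (hxs _).1, hv]) (Part.mem_some _)
  have hloop := exec_loop (e₁ := (b + 2, none)) (e₂ := (b, none)) (P := precStep G b)
    (fun j => withScratch b [num (v.head - j), history Y j, num j, num (Y j)] s) v.head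
    (by simp [TopTest.Holds]) (by simp [TopTest.Holds]) (by simp [TopTest.Holds])
    (fun j hj => by simp [TopTest.Holds]; lia)
    (fun j hj => by
      have hstep :=
        exec_precStep hG (fun i => (hxs i).1) hv (v.head - (j + 1)) (Y j) j (history Y j)
      rwa [show v.head - (j + 1) + 1 = v.head - j by lia] at hstep)
  exact hcopy.seq (Exec.seq (hpad ▸ hbase) (by simpa [history, Y] using hloop))

end prec

theorem implementable_of_primrec' {n : ℕ} {f : List.Vector ℕ n → ℕ} (hf : Nat.Primrec' f) :
    Implementable fun v => Part.some (f v) := by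
  induction hf with
  | zero => exact implementable_zero
  | succ => exact implementable_succ
  | get i => exact implementable_get i
  | comp g _ _ ihf ihg =>
    simpa only [← Part.pure_eq_some, List.Vector.mOfFn_pure, pure_bind] using
      implementable_comp ihf ihg
  | prec _ _ ihf ihg => exact implementable_prec ihf ihg

theorem implementable_of_partrec' {n : ℕ} {f : List.Vector ℕ n →. ℕ} (hf : Nat.Partrec' f) :
    Implementable f := by
  induction hf with
  | prim hf => exact implementable_of_primrec' hf
  | comp g _ _ ihf ihg => exact implementable_comp ihf ihg
  | rfind _ ih => exact implementable_rfind ih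

end Prog

/-! ### Words and numbers -/

/-- The number of a word in the standard correspondence: the inverse of `natToWord`. -/
def wordToNat (w : Word) : ℕ := w.foldl (fun n b => 2 * n + 1 + b.toNat) 0

@[simp] theorem wordToNat_nil : wordToNat [] = 0 := rfl

@[simp] theorem wordToNat_append_singleton (w : Word) (b : Bool) :
    wordToNat (w ++ [b]) = 2 * wordToNat w + 1 + b.toNat := by
  simp [wordToNat]

theorem wordToNat_take_succ {w : Word} {j : ℕ} (hj : j < w.length) :
    wordToNat (w.take (j + 1)) = 2 * wordToNat (w.take j) + 1 + w[j].toNat := by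
  rw [List.take_succ_eq_append_getElem hj, wordToNat_append_singleton]

namespace Prog

theorem exists_exec_replace {F G : ℕ →. ℕ} (hF : Partrec F) (hG : Partrec G) (b : ℕ) :
    ∃ P : Prog ℕ, ∀ (s : Store ℕ), ∀ n, ∀ m ∈ F n, n ∈ G m →
      P.Exec (withScratch b [num n] s) (withScratch b [num m] s) := by
  obtain ⟨P, hP⟩ := implementable_of_partrec' (Nat.Partrec'.part_iff₁.2 hF) (fun _ => b) (b + 1)
    (b + 2) (by simp) (by lia)
  obtain ⟨R, hR⟩ := implementable_of_partrec' (Nat.Partrec'.part_iff₁.2 hG) (fun _ => b + 1) b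
    (b + 2) (by simp) (by lia)
  refine ⟨P.seq (R.inv.seq (move (b + 1) b)), fun s n m hm hn => ?_⟩
  have hadd : P.Exec (withScratch b [num n] s) (withScratch b [num n, num m] s) :=
    hP.exec_append (v := n ::ᵥ .nil) rfl (by simp) (by simp [Subsingleton.elim _ (0 : Fin 1)]) hm
  have hremove : R.Exec (withScratch b [[], num m] s) (withScratch b [num n, num m] s) := by
    simpa [withScratch_withScratch] using
      hR (withScratch b [[], num m] s) (m ::ᵥ .nil) n (by simp [Subsingleton.elim _ (0 : Fin 1)]) hn
  have hmove : (move (b + 1) b).Exec (withScratch b [[], num m] s) (withScratch b [num m] s) := by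
    have hexec := exec_move (x := b + 1) (t := b) (n := m) (s := withScratch b [[], num m] s)
      (by lia) (by simp) (by simp)
    rw [update_withScratch_add (by simp)] at hexec
    have hend : withScratch b [num m, []] s = withScratch b [num m] s :=
      withScratch_append_nil (l := [num m])
    simpa [hend] using hexec
  exact hadd.seq (hremove.inv.seq hmove)

/-- Splitting the first bit off the word in register `0` and adding it to the registers `1` and
`2`. -/
def splitBit : Prog ℕ :=
  (loop (2, none) ((pop 0 true).seq ((push 0 false).seq ((push 1 true).seq (push 2 true))))
    (0, some false)).seq (pop 0 false)

theorem exec_splitBit (c : Bool) (w : Word) (n : ℕ) :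
    splitBit.Exec (withScratch 1 [num n] (wordStore 0 (c :: w)))
      (withScratch 1 [num (n + c.toNat), num c.toNat] (wordStore 0 w)) := by
  have hloop := exec_loop (e₁ := (2, none)) (e₂ := (0, some false))
    (P := (pop 0 true).seq ((push 0 false).seq ((push 1 true).seq (push 2 true))))
    (fun j => withScratch 1 [num (n + j), num j] (wordStore 0 ((c && j == 0) :: w))) c.toNat
    (by simp [TopTest.Holds, withScratch]) (by simp [TopTest.Holds, withScratch])
    (by cases c <;> simp [TopTest.Holds, withScratch, wordStore])
    (by cases c <;> simp [TopTest.Holds, withScratch, wordStore])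
    (fun j hj => by
      obtain ⟨rfl, rfl⟩ : c = true ∧ j = 0 := by cases c <;> simp_all
      refine (exec_pop (l := w) rfl rfl).seq
        ((exec_push rfl).seq ((exec_push rfl).seq (exec_push ?_)))
      funext r
      rcases r with _ | _ | _ | r <;> simp [withScratch, wordStore, num_succ])
  have hstart : withScratch 1 [num n, []] (wordStore 0 (c :: w)) =
      withScratch 1 [num n] (wordStore 0 (c :: w)) := withScratch_append_nil (l := [num n])
  refine Exec.seq (by simpa [hstart] using hloop) (exec_pop (l := w) ?_ ?_)
  · cases c <;> rfl
  · rw [update_withScratch_of_lt zero_lt_one]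
    simp only [wordStore, update_idem]

/-- The last bit that was read is recovered from the parity of the number, and so it can be
uncomputed. -/
theorem exists_exec_readBit : ∃ B : Prog ℕ, ∀ (c : Bool) (w : Word) (n : ℕ),
    B.Exec (withScratch 1 [num n] (wordStore 0 (c :: w)))
      (withScratch 1 [num (2 * n + 1 + c.toNat)] (wordStore 0 w)) := by
  have hhalf : Primrec fun n : ℕ => n / 2 := Primrec.nat_div.comp .id (.const 2)
  have hparity : Primrec fun n : ℕ => (n + 1) % 2 := Primrec.nat_mod.comp .succ (.const 2)
  obtain ⟨D, hD⟩ := exists_exec_replace Primrec.nat_double_succ.to_comp.partrec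
    hhalf.to_comp.partrec 1
  obtain ⟨B, hB⟩ := implementable_of_partrec'
    (Nat.Partrec'.part_iff₁.2 hparity.to_comp.partrec) (fun _ => 1) 2 3 (by simp) (by simp)
  refine ⟨D.seq (splitBit.seq B.inv), fun c w n => ?_⟩
  have hparity_eq : (2 * n + 1 + c.toNat + 1) % 2 = c.toNat := by
    have := c.toNat_lt
    lia
  have hcompute : B.Exec (withScratch 1 [num (2 * n + 1 + c.toNat)] (wordStore 0 w))
      (withScratch 1 [num (2 * n + 1 + c.toNat), num c.toNat] (wordStore 0 w)) :=
    hB.exec_append (b := 1) (r := 1) (l := [num (2 * n + 1 + c.toNat)]) (s := wordStore 0 w)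
      (v := (2 * n + 1 + c.toNat) ::ᵥ .nil) rfl one_lt_two
      (by simp [Subsingleton.elim _ (0 : Fin 1)]) (by simp [hparity_eq])
  exact (hD _ n (2 * n + 1) (by simp) (by simp; lia)).seq
    ((exec_splitBit c w (2 * n + 1)).seq hcompute.inv)

theorem exists_exec_wordToNat : ∃ P : Prog ℕ, ∀ w : Word,
    P.Exec (wordStore 0 w) (withScratch 1 [num (wordToNat w)] (wordStore 0 [])) := by
  obtain ⟨B, hB⟩ := exists_exec_readBit
  have hloop (w : Word) := exec_loop (e₁ := (1, none)) (e₂ := (0, none)) (P := B)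
    (fun j => withScratch 1 [num (wordToNat (w.take j))] (wordStore 0 (w.drop j))) w.length
    (by simp [TopTest.Holds, withScratch])
    (fun j hj => by simp [TopTest.Holds, withScratch, wordToNat_take_succ hj])
    (by simp [TopTest.Holds, withScratch, wordStore])
    (fun j hj => by simpa [TopTest.Holds, withScratch, wordStore] using hj)
    (fun j hj => by
      rw [List.drop_eq_getElem_cons hj, wordToNat_take_succ hj]
      exact hB _ _ _)
  have hstart (w : Word) : withScratch 1 [[]] (wordStore 0 w) = wordStore 0 w := by
    funext r
    rcases r with _ | _ | r <;> simp [withScratch, wordStore]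
  exact ⟨_, fun w => by simpa [hstart] using hloop w⟩

end Prog

/-- A partial recursive injection with a partial recursive inverse is computed by a reversible
machine. -/
theorem exists_isReversible_of_partrec {F G : ℕ →. ℕ} (hF : Partrec F) (hG : Partrec G) :
    ∃ R : TM, R.IsReversible ∧ ∀ w v : Word, wordToNat v ∈ F (wordToNat w) →
      wordToNat w ∈ G (wordToNat v) → R.Computes w v := by
  obtain ⟨W, hW⟩ := Prog.exists_exec_wordToNat
  obtain ⟨P, hP⟩ := Prog.exists_exec_replace hF hG 1
  obtain ⟨R, hR, hcomputes⟩ := Prog.exists_isReversible_computes (W.seq (P.seq W.inv))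
  exact ⟨R, hR, fun w v hv hw => hcomputes w v ((hW w).seq ((hP _ _ _ hv hw).seq (hW v).inv))⟩

theorem wordToNat_injective : Injective wordToNat := by
  intro w
  induction w using List.reverseRecOn with
  | nil =>
    intro w' h
    rcases List.eq_nil_or_concat' w' with rfl | ⟨l, c, rfl⟩
    · rfl
    · rw [wordToNat_nil, wordToNat_append_singleton] at h
      lia
  | append_singleton w b ih =>
    intro w' h
    rcases List.eq_nil_or_concat' w' with rfl | ⟨l, c, rfl⟩
    · rw [wordToNat_nil, wordToNat_append_singleton] at h
      lia
    · simp only [wordToNat_append_singleton] at h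
      have hb := b.toNat_lt
      have hc := c.toNat_lt
      rw [ih (show wordToNat w = wordToNat l by lia),
        (show ∀ b c : Bool, b.toNat = c.toNat → b = c by decide) b c (by lia)]

theorem natToWord_bit (n : ℕ) (b : Bool) :
    natToWord (2 * n + 1 + b.toNat) = natToWord n ++ [b] := by
  have hbit : 2 * n + 1 + b.toNat + 1 = Nat.bit b (n + 1) := by rw [Nat.bit_val]; lia
  have hne : (n + 1).bits ≠ [] := by
    rw [← List.length_pos_iff, Nat.size_eq_bits_len]
    exact Nat.size_pos.2 n.succ_pos
  rw [natToWord, hbit, Nat.bits_append_bit _ _ (by simp), List.dropLast_cons_of_ne_nil hne,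
    List.reverse_cons, natToWord]

theorem wordToNat_natToWord (n : ℕ) : wordToNat (natToWord n) = n := by
  induction n using Nat.strong_induction_on with
  | _ n ih =>
    rcases n.eq_zero_or_pos with rfl | hn
    · rfl
    · obtain ⟨m, b, rfl⟩ : ∃ m b, n = 2 * m + 1 + Bool.toNat b :=
        ⟨(n - 1) / 2, (n - 1).bodd, by
          have := Nat.mod_two_of_bodd (n - 1)
          lia⟩
      rw [natToWord_bit, wordToNat_append_singleton, ih m (by lia)]

theorem natToWord_wordToNat (w : Word) : natToWord (wordToNat w) = w :=
  wordToNat_injective (wordToNat_natToWord _)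

theorem natToWord_injective : Injective natToWord :=
  LeftInverse.injective wordToNat_natToWord

theorem length_natToWord_le (n : ℕ) : (natToWord n).length ≤ Nat.log 2 (n + 1) := by
  have hsize : (n + 1).size ≤ Nat.log 2 (n + 1) + 1 :=
    Nat.size_le.2 (Nat.lt_pow_succ_log_self one_lt_two _)
  rw [← Nat.size_eq_bits_len] at hsize
  simp only [natToWord, List.length_reverse, List.length_dropLast]
  lia

theorem primrec_wordToNat : Primrec wordToNat := by
  have htoNat : Primrec Bool.toNat := Primrec.dom_finite _
  have hstep : Primrec₂ fun (_ : Word) (r : ℕ × Bool) => 2 * r.1 + 1 + r.2.toNat :=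
    Primrec.nat_add.comp (Primrec.nat_double_succ.comp (Primrec.fst.comp .snd))
      (htoNat.comp (Primrec.snd.comp .snd))
  exact Primrec.list_foldl .id (.const 0) hstep

/-! ### Effective search -/

theorem exists_partrec_search {α β γ : Type*} [Primcodable α] [Primcodable β] [Primcodable γ]
    {G : α →. β × γ} (hG : Partrec G) : ∃ F : β →. γ, Partrec F ∧
      (∀ b, ∀ c ∈ F b, ∃ a, (b, c) ∈ G a) ∧ ∀ a b c, (b, c) ∈ G a → (F b).Dom := by
  classical
  obtain ⟨code, hcode⟩ := Nat.Partrec.Code.exists_code.1 hG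
  let f (b : β) (k : ℕ) : Option γ :=
    ((code.evaln k.unpair.2 k.unpair.1).bind (Encodable.decode (α := β × γ))).bind fun r =>
      if r.1 = b then some r.2 else none
  have hrun : Primrec₂ fun (_ : β) (k : ℕ) => code.evaln k.unpair.2 k.unpair.1 :=
    Nat.Partrec.Code.primrec_evaln.comp (((Primrec.snd.comp (Primrec.unpair.comp .snd)).pair
      (.const code)).pair (Primrec.fst.comp (Primrec.unpair.comp .snd)))
  have hf : Primrec₂ f := Primrec.option_bind
    (Primrec.option_bind hrun (Primrec.decode.comp .snd))
    (Primrec.ite (Primrec.eq.comp (Primrec.fst.comp .snd) (Primrec.fst.comp .fst))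
      (Primrec.option_some.comp (Primrec.snd.comp .snd)) (.const none))
  refine ⟨fun b => Nat.rfindOpt (f b), Partrec.rfindOpt hf.to_comp, fun b c hc => ?_,
    fun a b c hab => ?_⟩
  · obtain ⟨k, hk⟩ := Nat.rfindOpt_spec hc
    simp only [f, Option.mem_def, Option.bind_eq_some_iff, Option.ite_none_right_eq_some] at hk
    obtain ⟨⟨b', c'⟩, ⟨n, hn, hdecode⟩, rfl, hcc⟩ := hk
    replace hn := Nat.Partrec.Code.evaln_sound hn
    simp only [hcode, Part.mem_bind_iff, Part.mem_map_iff, Part.mem_ofOption] at hn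
    obtain ⟨a, -, r, hr, rfl⟩ := hn
    obtain rfl : r = (b', c') := by simpa using hdecode
    obtain rfl : c' = c := by simpa using hcc
    exact ⟨a, hr⟩
  · have hrun : Encodable.encode (b, c) ∈ code.eval (Encodable.encode a) := by
      rw [hcode]
      simpa using hab
    obtain ⟨k, hk⟩ := Nat.Partrec.Code.evaln_complete.1 hrun
    refine Nat.rfindOpt_dom.2 ⟨Nat.pair (Encodable.encode a) k, c, ?_⟩
    simp [f, Option.mem_def.1 hk]

theorem exists_partrec_mem_iff {α β γ : Type*} [Primcodable α] [Primcodable β] [Primcodable γ]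
    {G : α →. β × γ} (hG : Partrec G)
    (hunique : ∀ a a' b c c', (b, c) ∈ G a → (b, c') ∈ G a' → c = c') :
    ∃ F : β →. γ, Partrec F ∧ ∀ b c, c ∈ F b ↔ ∃ a, (b, c) ∈ G a := by
  obtain ⟨F, hF, hsound, hdom⟩ := exists_partrec_search hG
  refine ⟨F, hF, fun b c => ⟨hsound b c, fun ⟨a, ha⟩ => ?_⟩⟩
  obtain ⟨c', hc'⟩ := Part.dom_iff_mem.1 (hdom a b c ha)
  obtain ⟨a', ha'⟩ := hsound b c' hc'
  rwa [hunique a a' b c c' ha ha']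

theorem computable_natToWord : Computable natToWord := by
  have hunique : ∀ w w' : Word, ∀ n v v', (n, v) ∈ Part.some (wordToNat w, w) →
      (n, v') ∈ Part.some (wordToNat w', w') → v = v' := by
    simp only [Part.mem_some_iff, Prod.mk.injEq]
    rintro w w' n _ _ ⟨rfl, rfl⟩ ⟨h, rfl⟩
    exact wordToNat_injective h
  obtain ⟨F, hF, hmem⟩ := exists_partrec_mem_iff (G := fun w => Part.some (wordToNat w, w))
    (primrec_wordToNat.pair .id).to_comp.partrec hunique
  refine hF.of_eq fun n => Part.eq_some_iff.2 ((hmem _ _).2 ⟨natToWord n, ?_⟩)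
  rw [wordToNat_natToWord]
  exact Part.mem_some _

theorem exists_isReversible_of_partrec_injective {F : Word →. Word} (hF : Partrec F)
    (hinj : ∀ w w' v, v ∈ F w → v ∈ F w' → w = w') :
    ∃ R : TM, R.IsReversible ∧ ∀ w, ∀ v ∈ F w, R.Computes w v := by
  have hunique : ∀ w w' v u u', (v, u) ∈ (F w).map (fun v => (v, w)) →
      (v, u') ∈ (F w').map (fun v => (v, w')) → u = u' := by
    simp only [Part.mem_map_iff, Prod.mk.injEq]
    rintro w w' v _ _ ⟨_, hv, rfl, rfl⟩ ⟨_, hv', rfl, rfl⟩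
    exact hinj w w' _ hv hv'
  obtain ⟨G, hG, hmem⟩ := exists_partrec_mem_iff (G := fun w => (F w).map fun v => (v, w))
    (hF.map (Computable.snd.pair .fst)) hunique
  obtain ⟨R, hR, hcomputes⟩ := exists_isReversible_of_partrec
    (F := fun n => (F (natToWord n)).map wordToNat) (G := fun n => (G (natToWord n)).map wordToNat)
    ((hF.comp computable_natToWord).map (primrec_wordToNat.to_comp.comp .snd))
    ((hG.comp computable_natToWord).map (primrec_wordToNat.to_comp.comp .snd))
  refine ⟨R, hR, fun w v hv => hcomputes w v ?_ ?_⟩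
  · simpa [natToWord_wordToNat] using ⟨v, hv, rfl⟩
  · simpa [natToWord_wordToNat, hmem] using ⟨w, hv, rfl⟩

/-! ### Simulating Turing machines -/

section Tape

variable {Γ : Type} [Inhabited Γ] [DecidableEq Γ]

/-- The normal form of a half-tape: the list without the blanks at its end. -/
def stripBlanks (l : List Γ) : List Γ := l.rdropWhile (· = default)

theorem stripBlanks_append_replicate (l : List Γ) (n : ℕ) :
    stripBlanks (l ++ List.replicate n default) = stripBlanks l := by
  induction n with
  | zero => simp
  | succ n ih =>
    rw [List.replicate_succ', ← List.append_assoc, stripBlanks,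
      List.rdropWhile_concat_pos _ _ _ (by simp)]
    exact ih

theorem mk_stripBlanks (l : List Γ) :
    Turing.ListBlank.mk (stripBlanks l) = Turing.ListBlank.mk l := by
  refine Quotient.sound' (Or.inl ⟨(l.rtakeWhile (· = default)).length, ?_⟩)
  conv_lhs => rw [← List.rdropWhile_append_rtakeWhile (p := (· = default)) (l := l)]
  rw [stripBlanks, List.append_cancel_left_eq, List.eq_replicate_iff]
  exact ⟨rfl, fun a ha => by simpa using List.mem_rtakeWhile_imp ha⟩

theorem stripBlanks_stripBlanks (l : List Γ) : stripBlanks (stripBlanks l) = stripBlanks l :=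
  List.rdropWhile_idempotent _ _

theorem stripBlanks_map_some {A : Type} [DecidableEq A] (l : List A) :
    stripBlanks (l.map some) = l.map some := by
  refine List.rdropWhile_eq_self_iff.2 fun hl => ?_
  obtain ⟨a, -, ha⟩ := List.mem_map.1 (List.getLast_mem hl)
  simp [← ha]

/-- Half-tapes correspond to lists that do not end in a blank. -/
def listBlankEquiv : Turing.ListBlank Γ ≃ {l : List Γ // stripBlanks l = l} where
  toFun L := L.liftOn (fun l => ⟨stripBlanks l, stripBlanks_stripBlanks l⟩) (by
    rintro l _ ⟨n, rfl⟩
    exact Subtype.ext (stripBlanks_append_replicate l n).symm)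
  invFun l := .mk l
  left_inv L := L.induction_on mk_stripBlanks
  right_inv l := Subtype.ext l.2

theorem mk_listBlankEquiv (L : Turing.ListBlank Γ) : .mk (listBlankEquiv L).1 = L :=
  listBlankEquiv.symm_apply_apply L

theorem mk_map_some_injective {A : Type} :
    Injective fun l : List A => Turing.ListBlank.mk (l.map some) := by
  classical
  intro l l' h
  have h' : stripBlanks (l.map some) = stripBlanks (l'.map some) :=
    congrArg (fun L => (listBlankEquiv L).1) h
  rw [stripBlanks_map_some, stripBlanks_map_some] at h'
  exact List.map_injective_iff.2 (Option.some_injective _) h'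

/-- A tape consists of the scanned symbol and two half-tapes. -/
def tapeEquiv : Turing.Tape Γ ≃ Γ × Turing.ListBlank Γ × Turing.ListBlank Γ where
  toFun T := (T.head, T.left, T.right)
  invFun r := ⟨r.1, r.2.1, r.2.2⟩

variable [Primcodable Γ]

theorem primrec_stripBlanks : Primrec (stripBlanks : List Γ → List Γ) :=
  Primrec.list_reverse.comp ((Primrec.list_dropWhile
    (Primrec.eq.comp .id (.const default)).decide).comp .list_reverse)

instance : Primcodable {l : List Γ // stripBlanks l = l} :=
  .subtype (Primrec.eq.comp primrec_stripBlanks .id)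

instance : Primcodable (Turing.ListBlank Γ) := .ofEquiv _ listBlankEquiv

instance : Primcodable (Turing.Tape Γ) := .ofEquiv _ tapeEquiv

theorem primrec_listBlank_mk : Primrec (Turing.ListBlank.mk : List Γ → _) :=
  (Primrec.of_equiv_iff listBlankEquiv).1 (Primrec.subtype_mk primrec_stripBlanks)

theorem primrec_listBlankEquiv : Primrec fun L : Turing.ListBlank Γ => (listBlankEquiv L).1 :=
  Primrec.subtype_val.comp Primrec.of_equiv

theorem primrec_listBlank_head : Primrec (Turing.ListBlank.head : Turing.ListBlank Γ → Γ) :=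
  (Primrec.list_headI.comp primrec_listBlankEquiv).of_eq fun L => by
    rw [← Turing.ListBlank.head_mk, mk_listBlankEquiv]

theorem primrec_listBlank_tail : Primrec (Turing.ListBlank.tail : Turing.ListBlank Γ → _) :=
  (primrec_listBlank_mk.comp (Primrec.list_tail.comp primrec_listBlankEquiv)).of_eq fun L => by
    rw [← Turing.ListBlank.tail_mk, mk_listBlankEquiv]

theorem primrec_listBlank_cons : Primrec₂ (Turing.ListBlank.cons : Γ → Turing.ListBlank Γ → _) :=
  (primrec_listBlank_mk.comp
    (Primrec.list_cons.comp .fst (primrec_listBlankEquiv.comp .snd))).of_eq fun r => by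
      rw [← Turing.ListBlank.cons_mk, mk_listBlankEquiv]

section

variable {α : Type} [Primcodable α]

theorem primrec_tape_mk {a : α → Γ} {L R : α → Turing.ListBlank Γ} (ha : Primrec a)
    (hL : Primrec L) (hR : Primrec R) : Primrec fun x => Turing.Tape.mk (a x) (L x) (R x) :=
  (Primrec.of_equiv_iff tapeEquiv).1 (ha.pair (hL.pair hR))

theorem primrec_tape_head : Primrec (Turing.Tape.head : Turing.Tape Γ → Γ) :=
  Primrec.fst.comp (Primrec.of_equiv (e := tapeEquiv))

theorem primrec_tape_left : Primrec (Turing.Tape.left : Turing.Tape Γ → _) :=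
  (Primrec.fst.comp .snd).comp (Primrec.of_equiv (e := tapeEquiv))

theorem primrec_tape_right : Primrec (Turing.Tape.right : Turing.Tape Γ → _) :=
  (Primrec.snd.comp .snd).comp (Primrec.of_equiv (e := tapeEquiv))

theorem primrec_tape_mk₁ : Primrec (Turing.Tape.mk₁ : List Γ → _) :=
  primrec_tape_mk (primrec_listBlank_head.comp primrec_listBlank_mk)
    (primrec_listBlank_mk.comp (.const [])) (primrec_listBlank_tail.comp primrec_listBlank_mk)

theorem primrec_tape_write : Primrec₂ (Turing.Tape.write : Γ → Turing.Tape Γ → _) :=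
  primrec_tape_mk .fst (primrec_tape_left.comp .snd) (primrec_tape_right.comp .snd)

instance : Primcodable Turing.Dir :=
  .ofEquiv Bool ⟨(· = .left), (bif · then .left else .right), by rintro ⟨⟩ <;> rfl,
    by rintro ⟨⟩ <;> rfl⟩

theorem primrec_tape_move (d : Turing.Dir) :
    Primrec (Turing.Tape.move d : Turing.Tape Γ → _) := by
  have hhead := primrec_tape_head (Γ := Γ)
  have hleft := primrec_tape_left (Γ := Γ)
  have hright := primrec_tape_right (Γ := Γ)
  cases d with
  | left =>
    exact primrec_tape_mk (primrec_listBlank_head.comp hleft) (primrec_listBlank_tail.comp hleft)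
      (primrec_listBlank_cons.comp hhead hright)
  | right =>
    exact primrec_tape_mk (primrec_listBlank_head.comp hright)
      (primrec_listBlank_cons.comp hhead hleft) (primrec_listBlank_tail.comp hright)

theorem primrec_moveHead : Primrec₂ (TM.moveHead : _ → Turing.Tape Γ → _) := by
  have hmove : Primrec₂ fun (r : Option Turing.Dir × Turing.Tape Γ) (d : Turing.Dir) =>
      if d = .left then r.2.move .left else r.2.move .right :=
    Primrec.ite (Primrec.eq.comp .snd (.const Turing.Dir.left))
      ((primrec_tape_move .left).comp (Primrec.snd.comp .fst))
      ((primrec_tape_move .right).comp (Primrec.snd.comp .fst))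
  refine (Primrec.option_casesOn .fst .snd hmove).of_eq ?_
  rintro ⟨_ | _ | _, T⟩ <;> rfl

end
end Tape

/-! ### Computations of Turing machines -/

theorem reaches_iff_iterate {σ : Type*} {f : σ → Option σ} {a b : σ} :
    Reaches f a b ↔ ∃ t : ℕ, (fun o : Option σ => o.bind f)^[t] (some a) = some b := by
  constructor
  · intro h
    induction h with
    | refl => exact ⟨0, rfl⟩
    | tail _ hstep ih =>
      obtain ⟨t, ht⟩ := ih
      exact ⟨t + 1, by rwa [iterate_succ_apply', ht]⟩
  · rintro ⟨t, ht⟩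
    induction t generalizing b with
    | zero =>
      obtain rfl : a = b := by simpa using ht
      exact .refl
    | succ t ih =>
      rw [iterate_succ_apply', Option.bind_eq_some_iff] at ht
      obtain ⟨c, hc, hcb⟩ := ht
      exact (ih hc).tail hcb

namespace TM

section Primcodable

variable {M : TM} {k : ℕ} (e : M.ι ≃ Fin k)

/-- A configuration consists of a state and of a tape for each of the `k` tape names. -/
def cfgEquiv : M.Cfg ≃ M.Q × (Fin k → Turing.Tape (Option (Bool ⊕ M.A))) where
  toFun c := (c.state, c.tapes ∘ e.symm)
  invFun c := ⟨c.1, c.2 ∘ e⟩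
  left_inv c := by simp [Function.comp_assoc]
  right_inv c := by simp [Function.comp_assoc]

variable [Primcodable M.Q] [Primcodable M.A] [DecidableEq M.A]

/-- The encoding of configurations that belongs to a numbering `e` of the tapes. -/
abbrev primcodableCfg : Primcodable M.Cfg := .ofEquiv _ (cfgEquiv e)

theorem primrec_cfg_mk {α : Type} [Primcodable α] {q : α → M.Q}
    {T : α → M.ι → Turing.Tape (Option (Bool ⊕ M.A))} (hq : Primrec q)
    (hT : Primrec₂ fun x j => T x (e.symm j)) :
    letI := primcodableCfg e
    Primrec fun x => Cfg.mk (q x) (T x) :=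
  (Primrec.of_equiv_iff (cfgEquiv e)).1 (hq.pair (Primrec.fin_curry.2 hT))

theorem primrec_cfg_tapes :
    letI := primcodableCfg e
    Primrec₂ fun (c : M.Cfg) j => c.tapes (e.symm j) :=
  letI := primcodableCfg e
  Primrec.fin_app.comp (Primrec.snd.comp (Primrec.of_equiv.comp .fst)) .snd

theorem primrec_step [Finite M.Q] [Finite M.A] :
    letI := primcodableCfg e
    Primrec M.step := by
  let := primcodableCfg e
  have hstate : Primrec (Cfg.state (M := M)) := Primrec.fst.comp (.of_equiv (e := cfgEquiv e))
  have htape := primrec_cfg_tapes e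
  let δ' (r : M.Q × (Fin k → Option (Bool ⊕ M.A))) :
      Option (M.Q × (Fin k → Option (Bool ⊕ M.A) × Option Turing.Dir)) :=
    (M.δ r.1 (r.2 ∘ e)).map fun r => (r.1, r.2 ∘ e.symm)
  have hδ : Primrec fun c : M.Cfg => δ' (c.state, fun j => (c.tapes (e.symm j)).head) :=
    (Primrec.dom_finite δ').comp
      (hstate.pair (Primrec.fin_curry.2 (primrec_tape_head.comp₂ htape)))
  have haction : Primrec₂ fun
      (x : M.Cfg × M.Q × (Fin k → Option (Bool ⊕ M.A) × Option Turing.Dir)) j => x.2.2 j :=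
    Primrec.fin_app.comp (Primrec.snd.comp (Primrec.snd.comp .fst)) .snd
  have hact : Primrec₂ fun (x : M.Cfg × M.Q × (Fin k → _ × _)) j =>
      moveHead (x.2.2 j).2 ((x.1.tapes (e.symm j)).write (x.2.2 j).1) :=
    primrec_moveHead.comp (Primrec.snd.comp haction)
      (primrec_tape_write.comp (Primrec.fst.comp haction)
        (htape.comp (Primrec.fst.comp .fst) .snd))
  refine (Primrec.option_map hδ (g := fun c r => Cfg.mk r.1 fun i =>
    moveHead (r.2 (e i)).2 ((c.tapes i).write (r.2 (e i)).1))
    (primrec_cfg_mk e (Primrec.fst.comp .snd) (hact.of_eq fun x j => by simp))).of_eq fun c => ?_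
  simp [δ', step, Function.comp_def]

theorem primrec_wordCfg (q : M.Q) :
    letI := primcodableCfg e
    Primrec (M.wordCfg q) := by
  classical
  let : Primcodable M.ι := .ofEquiv _ e
  refine primrec_cfg_mk e (.const q) (primrec_tape_mk₁.comp ?_)
  exact Primrec.ite (Primrec.eq.comp (Primrec.of_equiv_symm.comp .snd) (.const M.io))
    (Primrec.list_map .fst (Primrec.option_some.comp (Primrec.sumInl.comp .snd))) (.const [])

end Primcodable

theorem exists_primcodable_cfg (M : TM) : ∃ _ : Primcodable M.Cfg,
    Primrec M.step ∧ ∀ q, Primrec (M.wordCfg q) := by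
  classical
  have := M.finQ
  have := M.finι
  have := M.finA
  obtain ⟨_, ⟨eQ⟩⟩ := Finite.exists_equiv_fin M.Q
  obtain ⟨_, ⟨eA⟩⟩ := Finite.exists_equiv_fin M.A
  obtain ⟨_, ⟨e⟩⟩ := Finite.exists_equiv_fin M.ι
  let : Primcodable M.Q := .ofEquiv _ eQ
  let : Primcodable M.A := .ofEquiv _ eA
  exact ⟨primcodableCfg e, primrec_step e, primrec_wordCfg e⟩

theorem exists_primrec_computes_iff (M : TM) : ∃ f : Word → Word → ℕ → Bool,
    (Primrec fun r : Word × Word × ℕ => f r.1 r.2.1 r.2.2) ∧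
      ∀ w v, M.Computes w v ↔ ∃ t, f w v t = true := by
  classical
  obtain ⟨_, hstep, hwordCfg⟩ := M.exists_primcodable_cfg
  refine ⟨fun w v t => decide ((fun o => o.bind M.step)^[t] (some (M.wordCfg M.start w)) =
    some (M.wordCfg M.final v)), ?_, fun w v => ?_⟩
  · have hbind : Primrec₂ fun (_ : Word × Word × ℕ) (o : Option M.Cfg) => o.bind M.step :=
      Primrec.option_bind .snd (hstep.comp₂ .right)
    exact (Primrec.eq.comp (Primrec.nat_iterate (.comp .snd .snd)
      (Primrec.option_some.comp ((hwordCfg _).comp .fst)) hbind)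
      (Primrec.option_some.comp ((hwordCfg _).comp (Primrec.fst.comp .snd)))).decide
  · simp only [decide_eq_true_eq]
    exact reaches_iff_iterate

theorem wordCfg_injective (M : TM) (q : M.Q) : Injective (M.wordCfg q) := by
  intro w w' h
  have htape := congrFun (congrArg Cfg.tapes h) M.io
  simp only [wordCfg, if_true, Turing.Tape.mk₁, Turing.Tape.mk₂] at htape
  have hcells := congrArg Turing.Tape.right₀ htape
  exact List.map_injective_iff.2 Sum.inl_injective
    (mk_map_some_injective (by simpa [Function.comp_def] using hcells))

theorem eq_of_reaches_wordCfg_start (M : TM) (hstart : ∀ q a r, M.δ q a = some r → r.1 ≠ M.start)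
    {c : M.Cfg} {w : Word} (h : Reaches M.step c (M.wordCfg M.start w)) :
    c = M.wordCfg M.start w := by
  rcases Relation.ReflTransGen.cases_tail h with h | ⟨d, -, hd⟩
  · exact h.symm
  · obtain ⟨r, hr, hdr⟩ := Option.map_eq_some_iff.1 hd
    exact absurd (congrArg Cfg.state hdr) (hstart _ _ _ hr)

theorem IsReversible.eq_of_computes {M : TM} (hM : M.IsReversible) {w w' v : Word}
    (h : M.Computes w v) (h' : M.Computes w' v) : w = w' := by
  rcases Relation.ReflTransGen.total_of_right_unique (r := swap fun a b => b ∈ M.step a)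
    (fun a b c hb hc => hM.1 _ _ _ hb hc) h.swap h'.swap with hww' | hww'
  · exact M.wordCfg_injective _ (M.eq_of_reaches_wordCfg_start hM.2 hww'.swap).symm
  · exact M.wordCfg_injective _ (M.eq_of_reaches_wordCfg_start hM.2 hww'.swap)

end TM

/-! ### Pairing -/

/-- The self-delimiting code `1^m 0 w` of a number together with a word, of which `pair x y` is
the instance `m = |x|`, `w = xy`. -/
def unaryPair (m : ℕ) (w : Word) : Word := List.replicate m true ++ false :: w

theorem unaryPair_inj {m m' : ℕ} {w w' : Word} :
    unaryPair m w = unaryPair m' w' ↔ m = m' ∧ w = w' := by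
  refine ⟨fun h => ?_, fun ⟨hm, hw⟩ => hm ▸ hw ▸ rfl⟩
  induction m generalizing m' with
  | zero => cases m' <;> simp_all [unaryPair, List.replicate_succ]
  | succ m ih =>
    cases m' with
    | zero => simp [unaryPair, List.replicate_succ] at h
    | succ m' => simpa using ih (List.cons.inj h).2

theorem pair_inj {x y x' y' : Word} : pair x y = pair x' y' ↔ x = x' ∧ y = y' := by
  refine ⟨fun h => ?_, fun ⟨hx, hy⟩ => hx ▸ hy ▸ rfl⟩
  obtain ⟨hlength, happend⟩ := unaryPair_inj.1 h
  exact List.append_inj happend hlength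

theorem length_pair (x y : Word) : (pair x y).length = 2 * x.length + 1 + y.length := by
  simp only [pair, List.length_append, List.length_replicate, List.length_cons]
  lia

theorem primrec_unaryPair : Primrec₂ unaryPair := by
  have hreplicate : Primrec fun m : ℕ => List.replicate m true :=
    (Primrec.list_map Primrec.list_range (Primrec.const true).to₂).of_eq fun m => by simp
  exact Primrec.list_append.comp (hreplicate.comp .fst)
    (Primrec.list_cons.comp (.const false) .snd)

theorem primrec_pair : Primrec₂ pair :=
  primrec_unaryPair.comp (Primrec.list_length.comp .fst) Primrec.list_append

/-! ### Complexity and irreversibility cost -/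

theorem condComplexity_le {U : Word →. Word} {x y p : Word} (h : x ∈ U (pair p y)) :
    condComplexity U x y ≤ p.length :=
  iInf₂_le p h

theorem TM.irrevCost_le {M : TM} {x y p q : Word} (h : M.Computes (pair x p) (pair y q)) :
    M.irrevCost x y ≤ (p.length + q.length : ℕ) :=
  (iInf_le _ p).trans (iInf₂_le q h)

theorem exists_mem_length_eq_of_condComplexity_eq {U : Word →. Word} {x y : Word} {n : ℕ}
    (h : condComplexity U x y = n) : ∃ p, x ∈ U (pair p y) ∧ p.length = n := by
  rw [condComplexity, iInf_subtype'] at h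
  have : Nonempty {p // x ∈ U (pair p y)} := by
    by_contra hempty
    rw [not_nonempty_iff] at hempty
    simp at h
  obtain ⟨⟨p, hp⟩, hlength⟩ := ciInf_mem fun p : {p // x ∈ U (pair p y)} => (p.1.length : ℕ∞)
  exact ⟨p, hp, Nat.cast_injective (hlength.trans h)⟩

theorem IsUniversal.exists_condComplexity_le_of_partrec {U : Word →. Word} (hU : IsUniversal U)
    {F : Word × Word →. Word} (hF : Partrec F) :
    ∃ c : ℕ, ∀ p y, ∀ x ∈ F (p, y), condComplexity U x y ≤ p.length + c := by
  have hunique : ∀ a a' w x x', (w, x) ∈ (F a).map (fun x => (pair a.1 a.2, x)) →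
      (w, x') ∈ (F a').map (fun x => (pair a'.1 a'.2, x)) → x = x' := by
    simp only [Part.mem_map_iff, Prod.mk.injEq]
    rintro a a' _ _ _ ⟨x, hx, rfl, rfl⟩ ⟨x', hx', hpair, rfl⟩
    obtain rfl : a' = a := Prod.ext_iff.2 (pair_inj.1 hpair)
    exact Part.mem_unique hx hx'
  obtain ⟨T, hT, hmem⟩ :=
    exists_partrec_mem_iff (G := fun a => (F a).map fun x => (pair a.1 a.2, x))
      (hF.map ((primrec_pair.to_comp.comp (Computable.fst.comp .fst)
        (Computable.snd.comp .fst)).pair .snd)) hunique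
  obtain ⟨i, hi⟩ := hU.2 T hT
  refine ⟨2 * i.length + 1, fun p y x hx => ?_⟩
  have hprogram : x ∈ U (pair (pair i p) y) := by
    rw [hi, hmem]
    exact ⟨(p, y), Part.mem_map _ hx⟩
  calc condComplexity U x y ≤ (pair i p).length := condComplexity_le hprogram
    _ = p.length + (2 * i.length + 1 : ℕ) := by rw [length_pair, add_comm, Nat.cast_add]

theorem IsUniversal.exists_condComplexity_le_length {U : Word →. Word} (hU : IsUniversal U) :
    ∃ c : ℕ, ∀ x y, condComplexity U x y ≤ x.length + c := by
  obtain ⟨c, hc⟩ := hU.exists_condComplexity_le_of_partrec Computable.fst.partrec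
  exact ⟨c, fun x y => hc x y x (Part.mem_some x)⟩

/-- Reversibility makes the garbage `q` left by an erasure determine the erased word. -/
theorem IsUniversal.exists_complexity_le_irrevCost {U : Word →. Word} (hU : IsUniversal U)
    {M : TM} (hM : M.IsReversible) :
    ∃ c : ℕ, ∀ x, complexity U x ≤ M.irrevCost x [] + c := by
  obtain ⟨f, hf, hcomputes⟩ := M.exists_primrec_computes_iff
  let G (a : (Word × Word) × Word × ℕ) : Option (Word × Word) :=
    if f (pair a.1.1 a.1.2) (pair [] a.2.1) a.2.2 = true then some (a.2.1, a.1.1) else none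
  have hG : Primrec G := by
    refine Primrec.ite (Primrec.eq.comp (hf.comp (.pair ?_ (.pair ?_ ?_))) (.const true))
      (Primrec.option_some.comp ((Primrec.fst.comp .snd).pair (Primrec.fst.comp .fst)))
      (.const none)
    · exact primrec_pair.comp (Primrec.fst.comp .fst) (Primrec.snd.comp .fst)
    · exact primrec_pair.comp (.const []) (Primrec.fst.comp .snd)
    · exact Primrec.snd.comp .snd
  have hmem (a q x) (h : (q, x) ∈ (G a : Part (Word × Word))) :
      ∃ p, M.Computes (pair x p) (pair [] q) := by
    simp only [G, Part.mem_ofOption, Option.mem_def, Option.ite_none_right_eq_some,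
      Option.some.injEq, Prod.mk.injEq] at h
    obtain ⟨ht, rfl, rfl⟩ := h
    exact ⟨_, (hcomputes _ _).2 ⟨_, ht⟩⟩
  obtain ⟨F, hF, hF_mem⟩ := exists_partrec_mem_iff (G := fun a => (G a : Part (Word × Word)))
    (Computable.ofOption hG.to_comp) fun a a' q x x' h h' => by
      obtain ⟨p, hp⟩ := hmem a q x h
      obtain ⟨p', hp'⟩ := hmem a' q x' h'
      exact (pair_inj.1 (hM.eq_of_computes hp hp')).1
  obtain ⟨c, hc⟩ := hU.exists_condComplexity_le_of_partrec (hF.comp .fst)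
  refine ⟨c, fun x => tsub_le_iff_right.1 (le_iInf₂ fun p q => le_iInf fun hpq => ?_)⟩
  obtain ⟨t, ht⟩ := (hcomputes _ _).1 hpq
  have hx : x ∈ F q := (hF_mem q x).2 ⟨((x, p), q, t), by simp [G, ht]⟩
  rw [tsub_le_iff_right]
  calc complexity U x ≤ q.length + c := hc q [] x hx
    _ ≤ (p.length + q.length : ℕ) + c := by gcongr; lia

/-! ### Erasure by a reversible machine -/

/-- `h` selects canonical programs for `U`: if some program of length `k` computes `z` from `y`,
then `h (z, y, k)` is one of them, and otherwise it is undefined. -/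
structure IsProgramSelector (U : Word →. Word) (h : Word × Word × ℕ →. Word) : Prop where
  partrec : Partrec h
  mem_apply {z y : Word} {k : ℕ} {p : Word} : p ∈ h (z, y, k) → z ∈ U (pair p y)
  length_eq {z y : Word} {k : ℕ} {p : Word} : p ∈ h (z, y, k) → p.length = k
  exists_mem {z y p : Word} : z ∈ U (pair p y) → ∃ p', p' ∈ h (z, y, p.length)

theorem exists_isProgramSelector {U : Word →. Word} (hU : Partrec U) :
    ∃ h, IsProgramSelector U h := by
  obtain ⟨h, hh, hsound, hdom⟩ := exists_partrec_search
    (G := fun a : Word × Word => (U (pair a.1 a.2)).map fun z => ((z, a.2, a.1.length), a.1))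
    ((hU.comp primrec_pair.to_comp).map ((Computable.snd.pair ((Computable.snd.comp .fst).pair
      (Primrec.list_length.to_comp.comp (Computable.fst.comp .fst)))).pair
      (Computable.fst.comp .fst)))
  have hspec {z y k p} (hp : p ∈ h (z, y, k)) : z ∈ U (pair p y) ∧ p.length = k := by
    obtain ⟨⟨p', y'⟩, hp'⟩ := hsound _ _ hp
    simp only [Part.mem_map_iff, Prod.mk.injEq] at hp'
    obtain ⟨_, hz, ⟨rfl, rfl, rfl⟩, rfl⟩ := hp'
    exact ⟨hz, rfl⟩
  exact ⟨h, hh, fun hp => (hspec hp).1, fun hp => (hspec hp).2, fun {z y p} hz =>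
    Part.dom_iff_mem.1 (hdom (p, y) _ p (Part.mem_map _ hz))⟩

/-- The pairs `(⟨x, s⟩, ⟨ε, 1^m 0 p⟩)` indexed by `(x, n, m)`, where `p` is the selected program of
length `n` for `x` and `s` is the selected program of length `m` that computes `n` from `x`. They
are the graph of an injection: `s` and `x` determine `n` and `m`, hence `p`, while `p` determines
`x` and `n`, hence with `m` also `s`. -/
def erasure (h : Word × Word × ℕ →. Word) (a : Word × ℕ × ℕ) : Part (Word × Word) :=
  (h (a.1, [], a.2.1)).bind fun p =>
    (h (natToWord a.2.1, a.1, a.2.2)).map fun s => (pair a.1 s, pair [] (unaryPair a.2.2 p))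

theorem mem_erasure_iff {h : Word × Word × ℕ →. Word} {x : Word} {n m : ℕ} {w v : Word} :
    (w, v) ∈ erasure h (x, n, m) ↔ ∃ p ∈ h (x, [], n), ∃ s ∈ h (natToWord n, x, m),
      pair x s = w ∧ pair [] (unaryPair m p) = v := by
  simp only [erasure, Part.mem_bind_iff, Part.mem_map_iff, Prod.mk.injEq]

namespace IsProgramSelector

variable {U : Word →. Word} {h : Word × Word × ℕ →. Word} (hh : IsProgramSelector U h)
include hh

theorem partrec_erasure : Partrec (erasure h) := by
  refine Partrec.bind (hh.partrec.comp ?_) (Partrec.map (hh.partrec.comp ?_) (.pair ?_ ?_))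
  · exact Computable.fst.pair ((Computable.const []).pair (Computable.fst.comp .snd))
  · exact (computable_natToWord.comp (Computable.fst.comp (Computable.snd.comp .fst))).pair
      ((Computable.fst.comp .fst).pair (Computable.snd.comp (Computable.snd.comp .fst)))
  · exact primrec_pair.to_comp.comp (Computable.fst.comp (Computable.fst.comp .fst)) .snd
  · exact primrec_pair.to_comp.comp (.const []) (primrec_unaryPair.to_comp.comp
      (Computable.snd.comp (Computable.snd.comp (Computable.fst.comp .fst)))
      (Computable.snd.comp .fst))

theorem erasure_snd_unique {a a' : Word × ℕ × ℕ} {w v v' : Word}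
    (hv : (w, v) ∈ erasure h a) (hv' : (w, v') ∈ erasure h a') : v = v' := by
  obtain ⟨x, n, m⟩ := a
  obtain ⟨x', n', m'⟩ := a'
  obtain ⟨p, hp, s, hs, rfl, rfl⟩ := mem_erasure_iff.1 hv
  obtain ⟨p', hp', s', hs', hw, rfl⟩ := mem_erasure_iff.1 hv'
  obtain ⟨rfl, rfl⟩ := pair_inj.1 hw
  obtain rfl : n = n' :=
    natToWord_injective (Part.mem_unique (hh.mem_apply hs) (hh.mem_apply hs'))
  obtain rfl : m = m' := (hh.length_eq hs).symm.trans (hh.length_eq hs')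
  rw [Part.mem_unique hp hp']

theorem erasure_fst_unique {a a' : Word × ℕ × ℕ} {w w' v : Word}
    (hw : (w, v) ∈ erasure h a) (hw' : (w', v) ∈ erasure h a') : w = w' := by
  obtain ⟨x, n, m⟩ := a
  obtain ⟨x', n', m'⟩ := a'
  obtain ⟨p, hp, s, hs, rfl, rfl⟩ := mem_erasure_iff.1 hw
  obtain ⟨p', hp', s', hs', rfl, hv⟩ := mem_erasure_iff.1 hw'
  obtain ⟨rfl, rfl⟩ := unaryPair_inj.1 (pair_inj.1 hv).2
  obtain rfl : x = x' := Part.mem_unique (hh.mem_apply hp) (hh.mem_apply hp')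
  obtain rfl : n = n' := (hh.length_eq hp).symm.trans (hh.length_eq hp')
  rw [Part.mem_unique hs hs']

theorem exists_isReversible_computes :
    ∃ R : TM, R.IsReversible ∧ ∀ a w v, (w, v) ∈ erasure h a → R.Computes w v := by
  obtain ⟨F, hF, hmem⟩ := exists_partrec_mem_iff hh.partrec_erasure
    fun _ _ _ _ _ => hh.erasure_snd_unique
  obtain ⟨R, hR, hcomputes⟩ := exists_isReversible_of_partrec_injective hF fun w w' v hw hw' => by
    obtain ⟨a, ha⟩ := (hmem w v).1 hw
    obtain ⟨a', ha'⟩ := (hmem w' v).1 hw'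
    exact hh.erasure_fst_unique ha ha'
  exact ⟨R, hR, fun a w v ha => hcomputes w v ((hmem w v).2 ⟨a, ha⟩)⟩

end IsProgramSelector

theorem exists_isReversible_irrevCost_le {U : Word →. Word} (hU : Partrec U) :
    ∃ R : TM, R.IsReversible ∧ ∀ x p s, x ∈ U (pair p []) → natToWord p.length ∈ U (pair s x) →
      R.irrevCost x [] ≤ (p.length + 2 * s.length + 1 : ℕ) := by
  obtain ⟨h, hh⟩ := exists_isProgramSelector hU
  obtain ⟨R, hR, hcomputes⟩ := hh.exists_isReversible_computes
  refine ⟨R, hR, fun x p s hp hs => ?_⟩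
  obtain ⟨p', hp'⟩ := hh.exists_mem hp
  obtain ⟨s', hs'⟩ := hh.exists_mem hs
  have hlength : s'.length + (unaryPair s.length p').length = p.length + 2 * s.length + 1 := by
    rw [unaryPair, List.length_append, List.length_replicate, List.length_cons,
      hh.length_eq hp', hh.length_eq hs']
    lia
  calc R.irrevCost x [] ≤ (s'.length + (unaryPair s.length p').length : ℕ) :=
        TM.irrevCost_le (hcomputes _ _ _ (mem_erasure_iff.2 ⟨p', hp', s', hs', rfl, rfl⟩))
    _ = (p.length + 2 * s.length + 1 : ℕ) := by rw [hlength]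

end RevErasure

theorem mainTheorem7 (U : RevErasure.Word →. RevErasure.Word) (hU : RevErasure.IsUniversal U)
    (UR : RevErasure.TM) (hUR : UR.IsUniversalReversible) :
    ∃ c : ℕ, ∀ x : RevErasure.Word, ∃ e n m : ℕ,
      UR.irrevCost x [] = (e : ℕ∞) ∧
      RevErasure.complexity U x = (n : ℕ∞) ∧
      RevErasure.condComplexity U (RevErasure.natToWord n) x = (m : ℕ∞) ∧
      n ≤ e + c ∧
      e ≤ n + 2 * m + c ∧
      m ≤ Nat.log 2 (n + 1) + c := by
  obtain ⟨c₁, hlength⟩ := hU.exists_condComplexity_le_length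
  obtain ⟨c₂, hlower⟩ := hU.exists_complexity_le_irrevCost hUR.1
  obtain ⟨R, hR, hRcost⟩ := RevErasure.exists_isReversible_irrevCost_le hU.1
  obtain ⟨c₃, hupper⟩ := hUR.2 R hR
  refine ⟨c₁ + c₂ + c₃ + 1, fun x => ?_⟩
  obtain ⟨n, hn, -⟩ := ENat.le_natCast_iff.1 (hlength x [])
  obtain ⟨m, hm, hm_le⟩ := ENat.le_natCast_iff.1 (hlength (RevErasure.natToWord n) x)
  obtain ⟨p, hp, rfl⟩ := RevErasure.exists_mem_length_eq_of_condComplexity_eq hn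
  obtain ⟨s, hs, rfl⟩ := RevErasure.exists_mem_length_eq_of_condComplexity_eq hm
  have hE : UR.irrevCost x [] ≤ (p.length + 2 * s.length + 1 + c₃ : ℕ) := by
    rw [Nat.cast_add]
    exact (hupper x []).trans (add_le_add_left (hRcost x p s hp hs) _)
  obtain ⟨e, he, he_le⟩ := ENat.le_natCast_iff.1 hE
  have he_ge : p.length ≤ e + c₂ := by
    have := hlower x
    rw [RevErasure.complexity, hn, he] at this
    exact_mod_cast this
  have hlog := RevErasure.length_natToWord_le p.length
  exact ⟨e, p.length, s.length, he, hn, hm, by lia, by lia, by lia⟩
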